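/- Let $\mathbf{Top}$ be the category of topological spaces. A subset $U$ of a space $X$ is *numerically open* if $P^{-1}(U)$ is open for every continuous map $P\colon V\to X$ from an open subset $V$ of a Euclidean space $\mathbb{R}^n$, $n\ge 0$. A space is *numerically generated* (equivalently, $\Delta$-generated) if each of its numerically open subsets is open. Let $\mathbf{NG}\subset\mathbf{Top}$ be the full subcategory of numerically generated spaces, $i\colon\mathbf{NG}\to\mathbf{Top}$ the inclusion, and $\nu\colon\mathbf{Top}\to\mathbf{NG}$ its right adjoint, which sends $X$ to the same set with the numerically open subsets of $X$ as open sets. Let $I$ be the set of boundary inclusions $S^{n-1}\to D^n$, $n\ge 0$ (with $S^{-1}=\emptyset$), and $J$ the set of inclusions $D^n\times\{0\}\to D^n\times[0,1]$, $n\ge 0$; all these spaces are numerically generated. A continuous map $f\colon X\to Y$ is a *weak homotopy equivalence* if it induces a bijection on sets of path components and isomorphisms $\pi_n(X,x)\to\pi_n(Y,f(x))$ for all $n\ge 1$ and $x\in X$. A model structure (on a category with all small limits and colimits, with functorial factorizations) is *cofibrantly generated* with generating cofibrations $I$ and generating trivial cofibrations $J$ if the fibrations are the maps with the right lifting property with respect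 to $J$, the trivial fibrations are the maps with the right lifting property with respect to $I$, and the domains of $I$ (resp. $J$) are small relative to the class of relative $I$-cell (resp. $J$-cell) complexes, that is, transfinite compositions of pushouts of elements of $I$ (resp. $J$). It is *finitely generated* if moreover the domains and codomains of $I$ and $J$ are finite relative to the relative $I$-cell complexes: for such an object $A$, $\mathrm{Hom}(A,-)$ commutes with the colimit of every colimit-preserving sequence, indexed by a nonzero limit ordinal, whose successor maps are relative $I$-cell complexes. **Theorem.** The category $\mathbf{NG}$ has a finitely generated model structure with $I$ as the set of generating cofibrations, $J$ as the set of generating trivial cofibrations, and the maps in $\mathbf{NG}$ that are weak homotopy equivalences in $\mathbf{Top}$ as weak equivalences. Moreover, let $\mathbf{Top}$ carry its standard model structure, i.e. the finitely generated model structure with generating cofibrations $I$, generating trivial cofibrations $J$, and the weak homotopy equivalences as weak equivalences (the existence of this structure is part of the assertion). Then the adjunction $i\dashv\nu$ is a Quillen equivalence: $i$ preserves cofibrations and trivial cofibrations, and for every cofibrant $X$ in $\mathbf{NG}$ and every fibrant $Y$ in $\mathbf{Top}$, a map $iX\to Y$ is a weak equivalence in $\mathbf{Top}$ if and only if its adjoint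 $X\to\nu Y$ is a weak equivalence in $\mathbf{NG}$. -/

import Mathlib

open CategoryTheory Limits HomotopicalAlgebra TopologicalSpace Topology

universe v u v' u'

/-! ### Smallness, finite generation and Quillen equivalences -/

section ModelStructures

variable {C : Type u} [Category.{v} C] {D : Type u'} [Category.{v'} D]

/-- `A` is `κ`-small relative to the class `W`: for every `κ`-filtered limit ordinal `J` and every
colimit-preserving sequence `F : J ⥤ C` whose successor maps `F j ⟶ F (j + 1)` belong to `W`,
the canonical map `colim Hom(A, F j) ⟶ Hom(A, colim F)` is bijective.
Limit ordinals are modelled by nonempty well-ordered types without largest element; such a `J` is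
`κ`-filtered when each of its subsets of cardinality at most `κ` is bounded. -/
def IsCardinalSmallRelativeTo (κ : Cardinal.{v}) (W : MorphismProperty C) (A : C) : Prop :=
  ∀ (J : Type v) [LinearOrder J] [SuccOrder J] [OrderBot J] [WellFoundedLT J] [NoMaxOrder J],
    (∀ S : Set J, Cardinal.mk S ≤ κ → BddAbove S) →
    ∀ (F : J ⥤ C) [F.IsWellOrderContinuous],
      (∀ j : J, W (F.map (homOfLE (Order.le_succ j)))) →
      PreservesColimit F (coyoneda.obj (Opposite.op A))

/-- `A` is small relative to `W`. -/
def IsSmallRelativeTo (W : MorphismProperty C) (A : C) : Prop :=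
  ∃ κ : Cardinal.{v}, IsCardinalSmallRelativeTo κ W A

/-- `A` is finite relative to `W`: it is `κ`-small relative to `W` for a finite cardinal `κ`. -/
def IsFiniteRelativeTo (W : MorphismProperty C) (A : C) : Prop :=
  ∃ κ : Cardinal.{v}, κ < Cardinal.aleph0 ∧ IsCardinalSmallRelativeTo κ W A

/-- The class of relative `I`-cell complexes: transfinite compositions of pushouts of
elements of `I`. -/
def relativeCells (I : MorphismProperty C) : MorphismProperty C :=
  MorphismProperty.transfiniteCompositions.{v} I.pushouts

/-- The model structure `M` on `C` (with all small limits and colimits and with functorial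
factorizations) is cofibrantly generated, with `I` as set of generating cofibrations and `J` as set
of generating trivial cofibrations. -/
structure IsCofibrantlyGeneratedBy (M : ModelCategory C) (I J : MorphismProperty C) : Prop where
  hasLimits : HasLimits C
  hasColimits : HasColimits C
  factorization_cofibrations :
    MorphismProperty.HasFunctorialFactorization (cofibrations C) (trivialFibrations C)
  factorization_trivialCofibrations :
    MorphismProperty.HasFunctorialFactorization (trivialCofibrations C) (fibrations C)
  isSmall_I : MorphismProperty.IsSmall.{v} I
  isSmall_J : MorphismProperty.IsSmall.{v} J
  small_domain_I : ∀ ⦃A B : C⦄ (i : A ⟶ B), I i → IsSmallRelativeTo (relativeCells I) A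
  small_domain_J : ∀ ⦃A B : C⦄ (j : A ⟶ B), J j → IsSmallRelativeTo (relativeCells J) A
  fibrations_eq : fibrations C = J.rlp
  trivialFibrations_eq : trivialFibrations C = I.rlp

/-- The model structure `M` is finitely generated by `I` and `J`: it is cofibrantly generated by
them, and the domains and codomains of `I` and `J` are finite relative to the relative `I`-cell
complexes. -/
structure IsFinitelyGeneratedBy (M : ModelCategory C) (I J : MorphismProperty C) : Prop
    extends IsCofibrantlyGeneratedBy M I J where
  finite_I : ∀ ⦃A B : C⦄ (i : A ⟶ B), I i →
    IsFiniteRelativeTo (relativeCells I) A ∧ IsFiniteRelativeTo (relativeCells I) B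
  finite_J : ∀ ⦃A B : C⦄ (j : A ⟶ B), J j →
    IsFiniteRelativeTo (relativeCells I) A ∧ IsFiniteRelativeTo (relativeCells I) B

/-- The class of weak equivalences of the model structure `M` is `W`. -/
def HasWeakEquivalences (M : ModelCategory C) (W : MorphismProperty C) : Prop :=
  weakEquivalences C = W

/-- An adjunction between model categories is a Quillen adjunction if the left adjoint preserves
cofibrations and trivial cofibrations. -/
structure IsQuillenAdjunction (M : ModelCategory C) (N : ModelCategory D) {F : C ⥤ D} {G : D ⥤ C}
    (adj : F ⊣ G) : Prop where
  map_cofibrations : ∀ ⦃A B : C⦄ (f : A ⟶ B), cofibrations C f → cofibrations D (F.map f)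
  map_trivialCofibrations : ∀ ⦃A B : C⦄ (f : A ⟶ B),
    trivialCofibrations C f → trivialCofibrations D (F.map f)

/-- A Quillen adjunction is a Quillen equivalence if, for all cofibrant `X` and fibrant `Y`,
a map `F X ⟶ Y` is a weak equivalence iff its adjoint `X ⟶ G Y` is. -/
structure IsQuillenEquivalence (M : ModelCategory C) (N : ModelCategory D) {F : C ⥤ D} {G : D ⥤ C}
    (adj : F ⊣ G) : Prop extends IsQuillenAdjunction M N adj where
  weakEquivalences_iff : ∀ (X : C) (Y : D) [IsCofibrant X] [IsFibrant Y] (f : F.obj X ⟶ Y),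
    weakEquivalences D f ↔ weakEquivalences C (adj.homEquiv X Y f)

end ModelStructures

/-! ### Weak homotopy equivalences -/

section WeakHomotopyEquivalences

variable {X Y : Type*} [TopologicalSpace X] [TopologicalSpace Y]

/-- The map induced by `f` on path components. -/
def pathComponentsMap (f : C(X, Y)) : ZerothHomotopy X → ZerothHomotopy Y :=
  ZerothHomotopy.lift (fun x => ZerothHomotopy.mk (f x))
    (fun _ _ p => ZerothHomotopy.sound (p.map f.continuous))

/-- The map induced by `f` on `n`-dimensional generalized loops `(Iⁿ, ∂Iⁿ) → (X, x)`. -/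
def genLoopMap (f : C(X, Y)) (n : ℕ) (x : X) (p : GenLoop (Fin n) X x) :
    GenLoop (Fin n) Y (f x) :=
  ⟨f.comp p.1, fun y hy => congrArg f (p.2 y hy)⟩

/-- The map `f_* : π_n(X, x) → π_n(Y, f x)` induced by `f`. -/
def homotopyGroupMap (f : C(X, Y)) (n : ℕ) (x : X) :
    HomotopyGroup.Pi n X x → HomotopyGroup.Pi n Y (f x) :=
  Quotient.map (genLoopMap f n x) fun _ _ h => h.map fun H => H.compContinuousMap f

/-- `f` is a weak homotopy equivalence: it induces a bijection on path components and
isomorphisms on all homotopy groups `π_n`, `n ≥ 1`, at all base points. -/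
structure IsWeakHomotopyEquivalence (f : C(X, Y)) : Prop where
  bijective_pathComponents : Function.Bijective (pathComponentsMap f)
  bijective_homotopyGroup : ∀ (n : ℕ), 1 ≤ n → ∀ x : X, Function.Bijective (homotopyGroupMap f n x)

end WeakHomotopyEquivalences

/-- The class of weak homotopy equivalences in the category of topological spaces. -/
def weakHomotopyEquivalences : MorphismProperty TopCat.{u} :=
  fun _ _ f => IsWeakHomotopyEquivalence f.hom

/-! ### Numerically generated spaces -/

/-- The family of all open subsets of all Euclidean spaces. -/
abbrev EuclideanOpens (V : Σ n : ℕ, Opens (EuclideanSpace ℝ (Fin n))) : Type := V.2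

/-- `U` is numerically open if its preimage under every continuous map from an open subset of
a Euclidean space is open. -/
def IsNumericallyOpen {X : Type*} [TopologicalSpace X] (U : Set X) : Prop :=
  ∀ (n : ℕ) (V : Opens (EuclideanSpace ℝ (Fin n))) (P : C(V, X)), IsOpen (P ⁻¹' U)

/-- Spaces generated by the open subsets of Euclidean spaces are the spaces
in which every numerically open subset is open. -/
theorem isGeneratedBy_euclideanOpens_iff (X : Type*) [TopologicalSpace X] :
    IsGeneratedBy EuclideanOpens X ↔ ∀ U : Set X, IsNumericallyOpen U → IsOpen U := by
  constructor
  · intro h U hU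
    exact (IsGeneratedBy.isOpen_iff EuclideanOpens).2 fun i f => hU i.1 i.2 f
  · intro h
    refine ⟨continuous_def.2 fun U hU => h _ fun n V P => ?_⟩
    exact WithGeneratedByTopology.isOpen_iff.1 hU (i := ⟨n, V⟩) P

/-- The full subcategory of `TopCat` of numerically generated spaces. -/
abbrev NG := GeneratedByTopCat.{u} EuclideanOpens

/-- The inclusion functor. -/
abbrev NG.incl : NG.{u} ⥤ TopCat.{u} := GeneratedByTopCat.toTopCat

/-- The functor `ν`, which replaces the topology of a space by the topology of all
numerically open subsets. -/
abbrev NG.nu : TopCat.{u} ⥤ NG.{u} := TopCat.toGeneratedByTopCat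

/-- The inclusion is left adjoint to `ν`; the counit `νX ⟶ X` is the identity on points. -/
abbrev NG.adj : NG.incl.{u} ⊣ NG.nu.{u} := GeneratedByTopCat.adj

/-- The open sets of `νX` are the numerically open sets of `X`. -/
theorem NG.isOpen_nu_iff (X : TopCat.{u}) (U : Set X) :
    IsOpen ((NG.adj.counit.app X).hom ⁻¹' U) ↔ IsNumericallyOpen U := by
  change IsOpen (WithGeneratedByTopology.equiv (X := EuclideanOpens) ⁻¹' U) ↔ _
  exact WithGeneratedByTopology.isOpen_iff.trans
    ⟨fun h n V P => h (i := ⟨n, V⟩) P, fun h i P => h i.1 i.2 P⟩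

/-- A retract of an open subset of a Euclidean space is numerically generated. -/
theorem isGeneratedBy_of_retract {X : Type*} [TopologicalSpace X] {n : ℕ}
    (V : Opens (EuclideanSpace ℝ (Fin n))) (s : X → V) (r : V → X) (hs : Continuous s)
    (hr : Continuous r) (hrs : ∀ x, r (s x) = x) : IsGeneratedBy EuclideanOpens X := by
  rw [isGeneratedBy_euclideanOpens_iff]
  intro U hU
  have h : s ⁻¹' (r ⁻¹' U) = U := by ext x; simp [hrs]
  rw [← h]
  exact (hU n V ⟨r, hr⟩).preimage hs

theorem IsGeneratedBy.of_homeomorph {X Y : Type*} [TopologicalSpace X] [TopologicalSpace Y]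
    (e : X ≃ₜ Y) (h : IsGeneratedBy EuclideanOpens X) : IsGeneratedBy EuclideanOpens Y :=
  e.isQuotientMap.isGeneratedBy

/-! ### Generating cofibrations -/

/-- The cylinder `Dⁿ × I`, where `I` is the unit interval. -/
noncomputable def diskProdInterval (n : ℕ) : TopCat.{u} :=
  TopCat.of (TopCat.disk.{u} n × unitInterval)

/-- The subspace `Dⁿ × {0}`. -/
noncomputable def diskProdZero (n : ℕ) : TopCat.{u} :=
  TopCat.of (TopCat.disk.{u} n × ({0} : Set unitInterval))

/-- The inclusion `Dⁿ × {0} ⟶ Dⁿ × I`. -/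
noncomputable def diskProdZeroInclusion (n : ℕ) : diskProdZero.{u} n ⟶ diskProdInterval.{u} n :=
  TopCat.ofHom ⟨Prod.map id Subtype.val, continuous_id.prodMap continuous_subtype_val⟩

/-- The set `I` of boundary inclusions `Sⁿ⁻¹ ⟶ Dⁿ`, `n ≥ 0`, in `TopCat` (where `S⁻¹ = ∅`). -/
def boundaryInclusions : MorphismProperty TopCat.{u} :=
  MorphismProperty.ofHoms fun n : ℕ => TopCat.diskBoundaryInclusion.{u} n

/-- The set `J` of inclusions `Dⁿ × {0} ⟶ Dⁿ × I`, `n ≥ 0`, in `TopCat`. -/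
def cylinderInclusions : MorphismProperty TopCat.{u} :=
  MorphismProperty.ofHoms fun n : ℕ => diskProdZeroInclusion.{u} n

namespace NG

theorem norm_clamp_le {n : ℕ} (v : EuclideanSpace ℝ (Fin n)) :
    (max 1 ‖v‖)⁻¹ • v ∈ Metric.closedBall (0 : EuclideanSpace ℝ (Fin n)) 1 := by
  have h : 0 < max 1 ‖v‖ := lt_of_lt_of_le one_pos (le_max_left _ _)
  rw [mem_closedBall_zero_iff, norm_smul, norm_inv, Real.norm_of_nonneg h.le, inv_mul_le_iff₀ h,
    mul_one]
  exact le_max_right _ _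

theorem continuous_clamp {n : ℕ} :
    Continuous fun v : EuclideanSpace ℝ (Fin n) => (max 1 ‖v‖)⁻¹ • v :=
  ((continuous_const.max continuous_norm).inv₀
    fun _ => (lt_of_lt_of_le one_pos (le_max_left _ _)).ne').smul continuous_id

theorem clamp_eq {n : ℕ} (v : EuclideanSpace ℝ (Fin n))
    (hv : v ∈ Metric.closedBall (0 : EuclideanSpace ℝ (Fin n)) 1) : (max 1 ‖v‖)⁻¹ • v = v := by
  rw [mem_closedBall_zero_iff] at hv
  rw [max_eq_left hv, inv_one, one_smul]

theorem isGeneratedBy_disk (n : ℕ) : IsGeneratedBy EuclideanOpens (TopCat.disk.{u} n) := by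
  refine IsGeneratedBy.of_homeomorph
    (X := Metric.closedBall (0 : EuclideanSpace ℝ (Fin n)) 1) Homeomorph.ulift.symm ?_
  refine isGeneratedBy_of_retract (n := n) ⊤ (fun x => ⟨x.1, trivial⟩)
    (fun v => ⟨_, norm_clamp_le v.1⟩) (by fun_prop)
    ((continuous_clamp.comp continuous_subtype_val).subtype_mk _) ?_
  intro x
  exact Subtype.ext (clamp_eq x.1 x.2)

theorem isGeneratedBy_diskBoundary (n : ℕ) :
    IsGeneratedBy EuclideanOpens (TopCat.diskBoundary.{u} n) := by
  refine IsGeneratedBy.of_homeomorph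
    (X := Metric.sphere (0 : EuclideanSpace ℝ (Fin n)) 1) Homeomorph.ulift.symm ?_
  have hne : ∀ v : ({0}ᶜ : Set (EuclideanSpace ℝ (Fin n))), ‖v.1‖ ≠ 0 :=
    fun v => norm_ne_zero_iff.2 v.2
  have hs : ∀ x : Metric.sphere (0 : EuclideanSpace ℝ (Fin n)) 1,
      x.1 ∈ ({0}ᶜ : Set (EuclideanSpace ℝ (Fin n))) := by
    intro x h
    have h1 := x.2
    rw [mem_sphere_zero_iff_norm, Set.mem_singleton_iff.1 h, norm_zero] at h1
    exact zero_ne_one h1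
  refine isGeneratedBy_of_retract (n := n) ⟨{0}ᶜ, isOpen_compl_singleton⟩
    (fun x => ⟨x.1, hs x⟩) (fun v => ⟨‖v.1‖⁻¹ • v.1, ?_⟩)
    (continuous_subtype_val.subtype_mk _) ?_ ?_
  · rw [mem_sphere_zero_iff_norm, norm_smul, norm_inv, norm_norm]
    exact inv_mul_cancel₀ (hne v)
  · exact (((continuous_norm.comp continuous_subtype_val).inv₀ hne).smul
      continuous_subtype_val).subtype_mk _
  · intro x
    refine Subtype.ext ?_
    have h1 := mem_sphere_zero_iff_norm.1 x.2
    simp [h1]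

theorem isGeneratedBy_diskProdInterval (n : ℕ) :
    IsGeneratedBy EuclideanOpens (diskProdInterval.{u} n) := by
  refine IsGeneratedBy.of_homeomorph
    (X := Metric.closedBall (0 : EuclideanSpace ℝ (Fin n)) 1 × unitInterval)
    (Homeomorph.ulift.symm.prodCongr (Homeomorph.refl _)) ?_
  refine isGeneratedBy_of_retract (n := n + 1) ⊤
    (fun x => ⟨WithLp.toLp 2 (Fin.cons (x.2 : ℝ) x.1.1.ofLp : Fin (n + 1) → ℝ), trivial⟩)
    (fun v => (⟨_, norm_clamp_le (WithLp.toLp 2 fun i : Fin n => v.1 i.succ)⟩,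
      Set.projIcc 0 1 zero_le_one (v.1 0))) ?_ ?_ ?_
  · refine Continuous.subtype_mk ((PiLp.continuous_toLp 2 _).comp (continuous_pi fun i => ?_)) _
    refine Fin.cases ?_ (fun i => ?_) i
    · simp only [Fin.cons_zero]; fun_prop
    · simp only [Fin.cons_succ]; fun_prop
  · refine Continuous.prodMk (Continuous.subtype_mk (continuous_clamp.comp ?_) _)
      (continuous_projIcc.comp ?_)
    · fun_prop
    · fun_prop
  · rintro ⟨x, t⟩
    refine Prod.ext (Subtype.ext ?_) ?_
    · exact clamp_eq x.1 x.2
    · exact Set.projIcc_val zero_le_one t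

theorem isGeneratedBy_diskProdZero (n : ℕ) :
    IsGeneratedBy EuclideanOpens (diskProdZero.{u} n) :=
  IsGeneratedBy.of_homeomorph (X := TopCat.disk.{u} n)
    (Homeomorph.prodUnique _ _).symm (isGeneratedBy_disk n)

/-- `Dⁿ` as a numerically generated space. -/
noncomputable def disk (n : ℕ) : NG.{u} := ⟨TopCat.disk n, isGeneratedBy_disk n⟩

/-- `Sⁿ⁻¹` as a numerically generated space. -/
noncomputable def diskBoundary (n : ℕ) : NG.{u} :=
  ⟨TopCat.diskBoundary n, isGeneratedBy_diskBoundary n⟩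

/-- `Dⁿ × I` as a numerically generated space. -/
noncomputable def diskProdInterval (n : ℕ) : NG.{u} :=
  ⟨_root_.diskProdInterval n, isGeneratedBy_diskProdInterval n⟩

/-- `Dⁿ × {0}` as a numerically generated space. -/
noncomputable def diskProdZero (n : ℕ) : NG.{u} :=
  ⟨_root_.diskProdZero n, isGeneratedBy_diskProdZero n⟩

/-- The set `I` of boundary inclusions `Sⁿ⁻¹ ⟶ Dⁿ`, `n ≥ 0`, in `NG`. -/
def boundaryInclusions : MorphismProperty NG.{u} :=
  MorphismProperty.ofHoms fun n : ℕ =>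
    (ObjectProperty.homMk (TopCat.diskBoundaryInclusion.{u} n) : diskBoundary.{u} n ⟶ disk.{u} n)

/-- The set `J` of inclusions `Dⁿ × {0} ⟶ Dⁿ × I`, `n ≥ 0`, in `NG`. -/
def cylinderInclusions : MorphismProperty NG.{u} :=
  MorphismProperty.ofHoms fun n : ℕ =>
    (ObjectProperty.homMk (diskProdZeroInclusion.{u} n) :
      diskProdZero.{u} n ⟶ diskProdInterval.{u} n)

/-- The class of maps in `NG` that are weak homotopy equivalences in `TopCat`. -/
def weakHomotopyEquivalences : MorphismProperty NG.{u} :=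
  _root_.weakHomotopyEquivalences.inverseImage NG.incl

end NG

/-! The model structure on spaces rests on two facts about lifting: the maps with the right lifting
property against `I` are the Serre fibrations that are weak homotopy equivalences
(`boundaryInclusions_rlp_eq`), and the maps with the left lifting property against all Serre
fibrations are weak homotopy equivalences (`cylinderInclusions_rlp_llp_le`).

Both become short once weak homotopy equivalences are described without base points: `f` is one
exactly when every square from a sphere inclusion to `f` can be deformed, through squares, to a
square with a lift (`isWeakHomotopyEquivalence_iff_homotopyLift`). A Serre fibration allows such a
deformation to be undone, which turns lifts up to homotopy into strict ones. A map with the left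
lifting property against Serre fibrations lifts against its own path fibration, hence is the
inclusion of a strong deformation retract.

The small object argument needs finiteness. The elements of `I` and `J` are closed embeddings with
relatively `T₁` complement, a class stable under pushouts, coproducts and transfinite compositions,
and a compact space mapping to a transfinite composition of such maps lands in one stage
(`exists_range_subset_range_incl`). The retract argument then gives the general criterion
`exists_isFinitelyGeneratedBy`.

Numerically generated spaces form a full coreflective subcategory containing `I` and `J`. Full
faithfulness makes lifting against `I` and `J` the same question in both categories, and the
inclusion preserves colimits, so all the hypotheses of the criterion pull back along it. Finally the
counit `νY ⟶ Y` lifts against the image of any map of `NG` (`hasLiftingProperty_counit`), so it is a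
trivial fibration; by two-out-of-three a map and its adjoint are weak equivalences together, which
is the Quillen equivalence. -/

section UnitInterval

open scoped unitInterval

/-! ### Lifting up to homotopy -/

section LiftingUpToHomotopy

variable {A B A' B' X Y : Type*} [TopologicalSpace A] [TopologicalSpace B]
  [TopologicalSpace A'] [TopologicalSpace B'] [TopologicalSpace X] [TopologicalSpace Y]

/-- `f` has the right lifting property with respect to `i`. -/
def StrictLift (i : C(A, B)) (f : C(X, Y)) : Prop :=
  ∀ (u : C(A, X)) (v : C(B, Y)), (∀ a, f (u a) = v (i a)) →
    ∃ w : C(B, X), (∀ a, w (i a) = u a) ∧ ∀ b, f (w b) = v b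

/-- The squares `(u₀, v₀)` and `(u₁, v₁)` from `i` to `f` are homotopic through squares. -/
def SquareHomotopic (i : C(A, B)) (f : C(X, Y)) (u₀ : C(A, X)) (v₀ : C(B, Y)) (u₁ : C(A, X))
    (v₁ : C(B, Y)) : Prop :=
  ∃ (U : u₀.Homotopy u₁) (V : v₀.Homotopy v₁), ∀ t a, f (U (t, a)) = V (t, i a)

/-- Every square from `i` to `f` is homotopic through squares to a square with a lift. -/
def HomotopyLift (i : C(A, B)) (f : C(X, Y)) : Prop :=
  ∀ (u : C(A, X)) (v : C(B, Y)), (∀ a, f (u a) = v (i a)) →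
    ∃ w : C(B, X), SquareHomotopic i f u v (w.comp i) (f.comp w)

/-- Every square from `i` to `f` has a lift making the upper triangle commute, and the lower one
up to a homotopy relative to `i`. -/
def RelLift (i : C(A, B)) (f : C(X, Y)) : Prop :=
  ∀ (u : C(A, X)) (v : C(B, Y)), (∀ a, f (u a) = v (i a)) →
    ∃ w : C(B, X), (∀ a, w (i a) = u a) ∧
      ∃ H : v.Homotopy (f.comp w), ∀ t a, H (t, i a) = v (i a)

theorem SquareHomotopic.trans {i : C(A, B)} {f : C(X, Y)} {u₀ u₁ u₂ : C(A, X)}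
    {v₀ v₁ v₂ : C(B, Y)} (h : SquareHomotopic i f u₀ v₀ u₁ v₁)
    (h' : SquareHomotopic i f u₁ v₁ u₂ v₂) : SquareHomotopic i f u₀ v₀ u₂ v₂ := by
  obtain ⟨U, V, h⟩ := h
  obtain ⟨U', V', h'⟩ := h'
  refine ⟨U.trans U', V.trans V', fun t a => ?_⟩
  rw [ContinuousMap.Homotopy.trans_apply, ContinuousMap.Homotopy.trans_apply]
  split_ifs
  · exact h _ _
  · exact h' _ _

theorem StrictLift.homotopyLift {i : C(A, B)} {f : C(X, Y)} (h : StrictLift i f) :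
    HomotopyLift i f := by
  intro u v huv
  obtain ⟨w, h₁, h₂⟩ := h u v huv
  obtain rfl : w.comp i = u := ContinuousMap.ext h₁
  obtain rfl : f.comp w = v := ContinuousMap.ext h₂
  exact ⟨w, .refl _, .refl _, fun _ _ => rfl⟩

/-- `i` is a retract of `j` in the category of arrows. -/
def IsArrowRetract (i : C(A, B)) (j : C(A', B')) : Prop :=
  ∃ (s₀ : C(A, A')) (s₁ : C(B, B')) (r₀ : C(A', A)) (r₁ : C(B', B)),
    (∀ a, j (s₀ a) = s₁ (i a)) ∧ (∀ a, i (r₀ a) = r₁ (j a)) ∧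
      (∀ a, r₀ (s₀ a) = a) ∧ ∀ b, r₁ (s₁ b) = b

/-- This and its two analogues below allow test inclusions to be exchanged freely: round balls,
cubes, prisms and boxes are all compared through retracts of arrows. -/
theorem StrictLift.of_retract {i : C(A, B)} {j : C(A', B')} {f : C(X, Y)} (h : StrictLift j f)
    (hij : IsArrowRetract i j) : StrictLift i f := by
  obtain ⟨s₀, s₁, r₀, r₁, hs, hr, h₀, h₁⟩ := hij
  intro u v huv
  obtain ⟨w, hw, hw'⟩ := h (u.comp r₀) (v.comp r₁) fun a => by
    simp only [ContinuousMap.comp_apply]; rw [huv, hr]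
  refine ⟨w.comp s₁, fun a => ?_, fun b => ?_⟩
  · simp only [ContinuousMap.comp_apply]
    rw [← hs, hw, ContinuousMap.comp_apply, h₀]
  · simp only [ContinuousMap.comp_apply]
    rw [hw', ContinuousMap.comp_apply, h₁]

theorem HomotopyLift.of_retract {i : C(A, B)} {j : C(A', B')} {f : C(X, Y)}
    (h : HomotopyLift j f) (hij : IsArrowRetract i j) : HomotopyLift i f := by
  obtain ⟨s₀, s₁, r₀, r₁, hs, hr, h₀, h₁⟩ := hij
  intro u v huv
  obtain ⟨w, U, V, hUV⟩ := h (u.comp r₀) (v.comp r₁) fun a => by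
    simp only [ContinuousMap.comp_apply]; rw [huv, hr]
  refine ⟨w.comp s₁, (U.compContinuousMap s₀).cast ?_ ?_, (V.compContinuousMap s₁).cast ?_ ?_,
    fun t a => ?_⟩
  · ext a; simp [h₀]
  · ext a; simp [hs]
  · ext a; simp [h₁]
  · ext a; simp
  · refine (hUV t (s₀ a)).trans ?_
    rw [hs]; rfl

theorem RelLift.of_retract {i : C(A, B)} {j : C(A', B')} {f : C(X, Y)}
    (h : RelLift j f) (hij : IsArrowRetract i j) : RelLift i f := by
  obtain ⟨s₀, s₁, r₀, r₁, hs, hr, h₀, h₁⟩ := hij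
  intro u v huv
  obtain ⟨w, hw, H, hH⟩ := h (u.comp r₀) (v.comp r₁) fun a => by
    simp only [ContinuousMap.comp_apply]; rw [huv, hr]
  refine ⟨w.comp s₁, fun a => ?_, (H.compContinuousMap s₁).cast ?_ ?_, fun t a => ?_⟩
  · simp only [ContinuousMap.comp_apply]
    rw [← hs, hw, ContinuousMap.comp_apply, h₀]
  · ext a; simp [h₁]
  · ext a; simp
  · refine Eq.trans (congrArg H (congrArg (Prod.mk t) (hs a).symm)) ((hH t (s₀ a)).trans ?_)
    simp only [ContinuousMap.comp_apply]
    rw [← hr, h₀]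

end LiftingUpToHomotopy

/-! ### Pairs of subsets -/

section Pairs

variable {B B' : Type*} [TopologicalSpace B] [TopologicalSpace B']

/-- The inclusion of a subset. -/
def subsetIncl (S : Set B) : C(S, B) := ⟨Subtype.val, continuous_subtype_val⟩

@[simp]
theorem subsetIncl_apply (S : Set B) (x : S) : subsetIncl S x = x := rfl

theorem isArrowRetract_of_homeomorph {S : Set B} {S' : Set B'} (e : B ≃ₜ B')
    (h : ∀ x, e x ∈ S' ↔ x ∈ S) : IsArrowRetract (subsetIncl S) (subsetIncl S') := by
  have h' : ∀ x, e.symm x ∈ S ↔ x ∈ S' := fun x => by rw [← h, e.apply_symm_apply]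
  refine ⟨⟨fun x => ⟨e x, (h _).2 x.2⟩, by fun_prop⟩, ⟨e, by fun_prop⟩,
    ⟨fun x => ⟨e.symm x, (h' _).2 x.2⟩, by fun_prop⟩, ⟨e.symm, by fun_prop⟩,
    fun _ => rfl, fun _ => rfl, fun a => ?_, fun b => ?_⟩
  · exact Subtype.ext (e.symm_apply_apply _)
  · exact e.symm_apply_apply _

end Pairs

/-! ### Unit balls and cubes -/

section Balls

variable (E E' : Type*) [NormedAddCommGroup E] [NormedAddCommGroup E']

/-- The closed unit ball. -/
abbrev UnitBall : Type _ := Metric.closedBall (0 : E) 1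

/-- The boundary of the closed unit ball. -/
def UnitBall.boundary : Set (UnitBall E) := {x | ‖(x : E)‖ = 1}

/-- The inclusion of the unit sphere in the closed unit ball. -/
abbrev sphereIncl : C(UnitBall.boundary E, UnitBall E) := subsetIncl (UnitBall.boundary E)

variable {E E'}

theorem UnitBall.norm_le (x : UnitBall E) : ‖(x : E)‖ ≤ 1 := mem_closedBall_zero_iff.1 x.2

theorem UnitBall.mem_boundary {x : UnitBall E} : x ∈ UnitBall.boundary E ↔ ‖(x : E)‖ = 1 := Iff.rfl

variable [NormedSpace ℝ E] [NormedSpace ℝ E']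

/-- A linear isomorphism carries the first ball to a bounded convex body with nonempty interior, and
any two such bodies are matched, frontier to frontier, by a homeomorphism of the ambient space.
Round balls and cubes thus become interchangeable. -/
theorem exists_unitBall_homeomorph [FiniteDimensional ℝ E] [FiniteDimensional ℝ E']
    (h : Module.finrank ℝ E = Module.finrank ℝ E') :
    ∃ e : UnitBall E ≃ₜ UnitBall E', ∀ x, e x ∈ UnitBall.boundary E' ↔ x ∈ UnitBall.boundary E := by
  let L : E ≃L[ℝ] E' := ContinuousLinearEquiv.ofFinrankEq h
  let s : Set E' := L '' Metric.closedBall 0 1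
  have hs : Convex ℝ s := (convex_closedBall 0 1).linear_image L.toLinearMap
  have hsi : interior s = L '' Metric.ball 0 1 := by
    rw [← interior_closedBall _ one_ne_zero]
    exact (L.toHomeomorph.image_interior _).symm
  have hsc : closure s = s :=
    (L.toHomeomorph.isClosedMap _ Metric.isClosed_closedBall).closure_eq
  have hsb : Bornology.IsBounded s := (L.lipschitz.isBounded_image Metric.isBounded_closedBall)
  have hsf : frontier s = L '' Metric.sphere 0 1 := by
    rw [← frontier_closedBall _ one_ne_zero]
    exact (L.toHomeomorph.image_frontier _).symm
  obtain ⟨g, -, hg₁, hg₂⟩ := exists_homeomorph_image_eq hs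
    (by rw [hsi]; exact (Metric.nonempty_ball.2 one_pos).image _)
    ((NormedSpace.isVonNBounded_iff ℝ).2 hsb)
    (convex_closedBall (0 : E') 1)
    (by rw [interior_closedBall _ one_ne_zero]; exact Metric.nonempty_ball.2 one_pos)
    ((NormedSpace.isVonNBounded_iff ℝ).2 Metric.isBounded_closedBall)
  rw [hsc, Metric.isClosed_closedBall.closure_eq] at hg₁
  rw [hsf, frontier_closedBall _ one_ne_zero] at hg₂
  let k : E ≃ₜ E' := L.toHomeomorph.trans g
  have hk₁ : ∀ x, k x ∈ Metric.closedBall (0 : E') 1 ↔ x ∈ Metric.closedBall (0 : E) 1 := by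
    intro x
    rw [← hg₁, ← Set.image_comp]
    exact k.injective.mem_set_image
  have hk₂ : ∀ x, k x ∈ Metric.sphere (0 : E') 1 ↔ x ∈ Metric.sphere (0 : E) 1 := by
    intro x
    rw [← hg₂, ← Set.image_comp]
    exact k.injective.mem_set_image
  refine ⟨k.subtype fun x => (hk₁ x).symm, fun x => ?_⟩
  have := hk₂ x
  rwa [mem_sphere_zero_iff_norm, mem_sphere_zero_iff_norm] at this

theorem isArrowRetract_sphereIncl [FiniteDimensional ℝ E] [FiniteDimensional ℝ E']
    (h : Module.finrank ℝ E = Module.finrank ℝ E') :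
    IsArrowRetract (sphereIncl E) (sphereIncl E') := by
  obtain ⟨e, he⟩ := exists_unitBall_homeomorph h
  exact isArrowRetract_of_homeomorph e he

end Balls


section Cubes

/-- The inclusion of the boundary of a cube. -/
abbrev cubeIncl (n : ℕ) : C(Cube.boundary (Fin n), Fin n → I) := subsetIncl (Cube.boundary (Fin n))

/-- The boundary of `I × Iⁿ`. -/
def prismBoundary (n : ℕ) : Set (I × (Fin n → I)) :=
  {x | x.1 = 0 ∨ x.1 = 1 ∨ x.2 ∈ Cube.boundary (Fin n)}

/-- The inclusion of the boundary of `I × Iⁿ`. -/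
abbrev prismIncl (n : ℕ) : C(prismBoundary n, I × (Fin n → I)) := subsetIncl (prismBoundary n)

/-- The affine homeomorphism `[0, 1] → [-1, 1]`. -/
theorem abs_two_mul_sub_one_le (t : I) : |2 * (t : ℝ) - 1| ≤ 1 := by
  rw [abs_le]; constructor <;> linarith [t.2.1, t.2.2]

theorem abs_two_mul_sub_one_eq (t : I) : |2 * (t : ℝ) - 1| = 1 ↔ t = 0 ∨ t = 1 := by
  rw [abs_eq zero_le_one]
  constructor
  · rintro (h | h)
    · right; ext; rw [Set.Icc.coe_one]; linarith
    · left; ext; rw [Set.Icc.coe_zero]; linarith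
  · rintro (rfl | rfl)
    · right; simp
    · left; simp; norm_num

theorem norm_fin_eq_one_iff {n : ℕ} {x : Fin n → ℝ} (hx : ∀ i, |x i| ≤ 1) :
    ‖x‖ = 1 ↔ ∃ i, |x i| = 1 := by
  constructor
  · intro h
    by_contra! hne
    have : ‖x‖ < 1 := (pi_norm_lt_iff one_pos).2 fun i => lt_of_le_of_ne (hx i) (hne i)
    exact this.ne h
  · rintro ⟨i, hi⟩
    refine le_antisymm ((pi_norm_le_iff_of_nonneg zero_le_one).2 hx) ?_
    rw [← hi]
    exact norm_le_pi_norm x i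

/-- The cube `Iⁿ` is the closed unit ball of `ℝⁿ` for the supremum norm. -/
noncomputable def cubeHomeomorph (n : ℕ) : (Fin n → I) ≃ₜ UnitBall (Fin n → ℝ) where
  toFun y := ⟨fun i => 2 * (y i : ℝ) - 1, mem_closedBall_zero_iff.2
    ((pi_norm_le_iff_of_nonneg zero_le_one).2 fun i => abs_two_mul_sub_one_le _)⟩
  invFun x i := Set.projIcc 0 1 zero_le_one (((x : Fin n → ℝ) i + 1) / 2)
  left_inv y := by
    ext i
    simp
  right_inv x := by
    have h : ∀ i, |(x : Fin n → ℝ) i| ≤ 1 := fun i => (norm_le_pi_norm (x : Fin n → ℝ) i).trans x.norm_le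
    ext i
    have := abs_le.1 (h i)
    simp only
    rw [Set.projIcc_of_mem zero_le_one ⟨by linarith, by linarith⟩]
    ring
  continuous_toFun := by fun_prop
  continuous_invFun := by
    refine continuous_pi fun i => continuous_projIcc.comp ?_
    exact (((continuous_apply i).comp continuous_subtype_val).add continuous_const).div_const _

theorem cubeHomeomorph_mem_boundary {n : ℕ} (y : Fin n → I) :
    cubeHomeomorph n y ∈ UnitBall.boundary _ ↔ y ∈ Cube.boundary (Fin n) := by
  refine (norm_fin_eq_one_iff fun i => abs_two_mul_sub_one_le _).trans ?_
  exact exists_congr fun i => abs_two_mul_sub_one_eq _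

/-- The prism `I × Iⁿ` is the closed unit ball of `ℝ × ℝⁿ` for the supremum norm. -/
noncomputable def prismHomeomorph (n : ℕ) : I × (Fin n → I) ≃ₜ UnitBall (ℝ × (Fin n → ℝ)) where
  toFun y := ⟨(2 * (y.1 : ℝ) - 1, cubeHomeomorph n y.2), mem_closedBall_zero_iff.2
    (max_le (abs_two_mul_sub_one_le _) (cubeHomeomorph n y.2).norm_le)⟩
  invFun x := (Set.projIcc 0 1 zero_le_one ((x.1.1 + 1) / 2), (cubeHomeomorph n).symm
    ⟨x.1.2, mem_closedBall_zero_iff.2 ((le_max_right _ _).trans x.norm_le)⟩)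
  left_inv y := by
    ext1
    · simp
    · exact (cubeHomeomorph n).symm_apply_apply _
  right_inv x := by
    have := abs_le.1 ((le_max_left _ _).trans x.norm_le : |x.1.1| ≤ 1)
    refine Subtype.ext (Prod.ext ?_ ?_)
    · simp only
      rw [Set.projIcc_of_mem zero_le_one ⟨by linarith, by linarith⟩]
      ring
    · exact congrArg Subtype.val ((cubeHomeomorph n).apply_symm_apply _)
  continuous_toFun := by fun_prop
  continuous_invFun := by
    refine Continuous.prodMk (continuous_projIcc.comp (by fun_prop))
      ((cubeHomeomorph n).symm.continuous.comp (by fun_prop))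

theorem prismHomeomorph_mem_boundary {n : ℕ} (y : I × (Fin n → I)) :
    prismHomeomorph n y ∈ UnitBall.boundary _ ↔ y ∈ prismBoundary n := by
  have h₁ : |2 * (y.1 : ℝ) - 1| ≤ 1 := abs_two_mul_sub_one_le _
  have h₂ := (cubeHomeomorph n y.2).norm_le
  have : ‖(prismHomeomorph n y : ℝ × (Fin n → ℝ))‖ =
    max |2 * (y.1 : ℝ) - 1| ‖(cubeHomeomorph n y.2 : Fin n → ℝ)‖ := rfl
  rw [UnitBall.mem_boundary, this, prismBoundary, Set.mem_ofPred_eq, ← or_assoc,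
    ← abs_two_mul_sub_one_eq, ← cubeHomeomorph_mem_boundary, UnitBall.mem_boundary]
  constructor
  · intro h
    by_contra! hne
    exact (max_lt (lt_of_le_of_ne h₁ hne.1) (lt_of_le_of_ne h₂ hne.2)).ne h
  · rintro (h | h)
    · rw [h, max_eq_left h₂]
    · rw [h, max_eq_right h₁]

theorem isArrowRetract_cubeIncl (n : ℕ) :
    IsArrowRetract (cubeIncl n) (sphereIncl (Fin n → ℝ)) :=
  isArrowRetract_of_homeomorph _ cubeHomeomorph_mem_boundary

theorem isArrowRetract_prismIncl (n : ℕ) :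
    IsArrowRetract (prismIncl n) (sphereIncl (ℝ × (Fin n → ℝ))) :=
  isArrowRetract_of_homeomorph _ prismHomeomorph_mem_boundary

end Cubes

/-! ### From lifts up to homotopy to weak homotopy equivalences -/

theorem exists_continuousMap_glue {Z W : Type*} [TopologicalSpace Z] [TopologicalSpace W]
    {P Q : Set Z} (hP : IsClosed P) (hQ : IsClosed Q) (hPQ : ∀ z, z ∈ P ∨ z ∈ Q)
    (F : C(P, W)) (G : C(Q, W)) (h : ∀ z (hp : z ∈ P) (hq : z ∈ Q), F ⟨z, hp⟩ = G ⟨z, hq⟩) :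
    ∃ H : C(Z, W), (∀ z (hp : z ∈ P), H z = F ⟨z, hp⟩) ∧ ∀ z (hq : z ∈ Q), H z = G ⟨z, hq⟩ := by
  classical
  let H : Z → W := fun z =>
    if hp : z ∈ P then F ⟨z, hp⟩ else G ⟨z, (hPQ z).resolve_left hp⟩
  have h₁ : ∀ z (hp : z ∈ P), H z = F ⟨z, hp⟩ := fun z hp => dif_pos hp
  have h₂ : ∀ z (hq : z ∈ Q), H z = G ⟨z, hq⟩ := by
    intro z hq
    by_cases hp : z ∈ P
    · rw [h₁ z hp, h z hp hq]
    · exact dif_neg hp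
  have hc : Continuous H := by
    rw [← continuousOn_univ, ← Set.eq_univ_of_forall (s := P ∪ Q) hPQ]
    refine ContinuousOn.union_of_isClosed ?_ ?_ hP hQ
    · rw [continuousOn_iff_continuous_domRestrict]
      exact F.continuous.congr fun z => (h₁ z z.2).symm
    · rw [continuousOn_iff_continuous_domRestrict]
      exact G.continuous.congr fun z => (h₂ z z.2).symm
  exact ⟨⟨H, hc⟩, h₁, h₂⟩

/-! ### Making a homotopy of squares relative to the sphere -/

section RelativeLifts

variable {E X Y : Type*} [NormedAddCommGroup E] [NormedSpace ℝ E] [TopologicalSpace X]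
  [TopologicalSpace Y]

/-- The dilation of the unit ball by `1 + s`, followed by the radial retraction. -/
noncomputable def UnitBall.dilate : C(I × UnitBall E, UnitBall E) where
  toFun p := ⟨((1 + (p.1 : ℝ)) / max 1 ((1 + p.1) * ‖(p.2 : E)‖)) • (p.2 : E), by
    have h₀ : 0 ≤ 1 + (p.1 : ℝ) := by linarith [p.1.2.1]
    have h₁ : 0 < max 1 ((1 + (p.1 : ℝ)) * ‖(p.2 : E)‖) := lt_max_of_lt_left one_pos
    rw [mem_closedBall_zero_iff, norm_smul, Real.norm_of_nonneg (by positivity), div_mul_eq_mul_div,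
      div_le_one h₁]
    exact le_max_right _ _⟩
  continuous_toFun := by
    refine Continuous.subtype_mk (Continuous.smul (Continuous.div ?_ ?_ fun p =>
      (lt_max_of_lt_left one_pos).ne') ?_) _ <;> fun_prop

theorem UnitBall.dilate_of_le (s : I) (x : UnitBall E) (h : (1 + s) * ‖(x : E)‖ ≤ 1) :
    (UnitBall.dilate (s, x) : E) = (1 + (s : ℝ)) • (x : E) := by
  simp only [UnitBall.dilate, ContinuousMap.coe_mk]
  rw [max_eq_left h, div_one]

theorem UnitBall.dilate_of_ge (s : I) (x : UnitBall E) (h : 1 ≤ (1 + s) * ‖(x : E)‖) :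
    (UnitBall.dilate (s, x) : E) = ‖(x : E)‖⁻¹ • (x : E) := by
  simp only [UnitBall.dilate, ContinuousMap.coe_mk]
  rw [max_eq_right h, div_mul_eq_div_div, div_self, one_div]
  linarith [s.2.1]

theorem UnitBall.dilate_mem_boundary (s : I) (x : UnitBall E) (h : 1 ≤ (1 + s) * ‖(x : E)‖) :
    UnitBall.dilate (s, x) ∈ UnitBall.boundary E := by
  rw [UnitBall.mem_boundary, UnitBall.dilate_of_ge s x h, norm_smul, norm_inv, norm_norm,
    inv_mul_cancel₀]
  intro h₀
  rw [h₀, mul_zero] at h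
  exact absurd h (by norm_num)

theorem UnitBall.dilate_of_mem_boundary (s : I) {x : UnitBall E} (h : x ∈ UnitBall.boundary E) :
    UnitBall.dilate (s, x) = x := by
  rw [UnitBall.mem_boundary] at h
  ext1
  rw [UnitBall.dilate_of_ge s x (by rw [h]; linarith [s.2.1]), h, inv_one, one_smul]

/-- The depth in the shell removed by the dilation of the unit ball by `1 + s`. -/
noncomputable def UnitBall.depth : C(I × UnitBall E, I) where
  toFun p := ⟨min p.1 ((1 + p.1) * (1 - ‖(p.2 : E)‖)), le_min p.1.2.1
    (mul_nonneg (by linarith [p.1.2.1]) (by linarith [p.2.norm_le])),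
    (min_le_left _ _).trans p.1.2.2⟩
  continuous_toFun := by fun_prop

/-- The homotopy `U` of the boundary map is absorbed in a collar: the lift `w₀` is shrunk to the
ball of radius 1/2, and the remaining shell carries `U`, run from time 1 on the inside to time 0 on
the sphere. -/
theorem HomotopyLift.relLift {f : C(X, Y)} (h : HomotopyLift (sphereIncl E) f) :
    RelLift (sphereIncl E) f := by
  intro u v huv
  obtain ⟨w₀, U, V, hUV⟩ := h u v huv
  -- The core and the shell at time 1, meeting along the sphere of radius 1/2.
  let P : Set (UnitBall E) := {x | (1 + ((1 : I) : ℝ)) * ‖(x : E)‖ ≤ 1}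
  let Q : Set (UnitBall E) := {x | 1 ≤ (1 + ((1 : I) : ℝ)) * ‖(x : E)‖}
  have hdepth : ∀ x ∈ P, UnitBall.depth ((1 : I), x) = 1 := by
    intro x hx
    ext
    simp only [P, Set.mem_ofPred_eq, Set.Icc.coe_one] at hx
    simp only [UnitBall.depth, ContinuousMap.coe_mk, Set.Icc.coe_one]
    exact min_eq_left (by linarith)
  obtain ⟨w, hw₁, hw₂⟩ := exists_continuousMap_glue (P := P) (Q := Q)
    (isClosed_le (by fun_prop) (by fun_prop)) (isClosed_le (by fun_prop) (by fun_prop))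
    (fun x => le_total ((1 + ((1 : I) : ℝ)) * ‖(x : E)‖) 1) (w₀.comp ⟨fun x => UnitBall.dilate (1, x.1), by fun_prop⟩)
    (U.toContinuousMap.comp ⟨fun x => (UnitBall.depth (1, x.1),
      ⟨UnitBall.dilate (1, x.1), UnitBall.dilate_mem_boundary 1 x.1 x.2⟩), by fun_prop⟩)
    (fun x hp hq => by
      simp only [ContinuousMap.comp_apply, ContinuousMap.coe_mk, hdepth x hp]
      exact (U.apply_one ⟨_, UnitBall.dilate_mem_boundary 1 x hq⟩).symm)
  -- At time `s` the core has radius `1 / (1 + s)`; there the depth is `s`, and it decreases to 0 on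
  -- the boundary sphere. Hence `V (depth, dilate)` starts at `v`, ends at `f ∘ w` and is fixed on
  -- the sphere.
  refine ⟨w, fun a => ?_, ⟨⟨V.toContinuousMap.comp
    ⟨fun p => (UnitBall.depth p, UnitBall.dilate p), by fun_prop⟩, fun x => ?_, fun x => ?_⟩, ?_⟩⟩
  · have ha : ‖(a.1 : E)‖ = 1 := a.2
    have hd : UnitBall.depth ((1 : I), a.1) = 0 := by
      ext
      simp [UnitBall.depth, ha]
    refine (hw₂ _ (by simp [Q, ha])).trans ?_
    have hb : (⟨UnitBall.dilate (1, a.1), UnitBall.dilate_mem_boundary 1 a.1 (by simp [ha])⟩ :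
        UnitBall.boundary E) = a := Subtype.ext (UnitBall.dilate_of_mem_boundary 1 a.2)
    change U (UnitBall.depth ((1 : I), a.1), ⟨UnitBall.dilate (1, a.1), _⟩) = _
    rw [hd, hb]
    exact U.apply_zero a
  · have hd : UnitBall.depth ((0 : I), x) = 0 := by
      ext
      simp [UnitBall.depth, x.norm_le]
    have hx : UnitBall.dilate ((0 : I), x) = x := by
      ext1
      rw [UnitBall.dilate_of_le _ _ (by simpa using x.norm_le)]
      simp
    simp only [ContinuousMap.comp_apply, ContinuousMap.coe_mk, hd, ContinuousMap.toFun_eq_coe, hx]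
    exact V.apply_zero x
  · simp only [ContinuousMap.comp_apply, ContinuousMap.coe_mk, ContinuousMap.toFun_eq_coe]
    rcases le_total ((1 + ((1 : I) : ℝ)) * ‖(x : E)‖) 1 with hx | hx
    · rw [hw₁ x hx, hdepth x hx]
      exact V.apply_one _
    · rw [hw₂ x hx]
      exact (hUV _ ⟨_, UnitBall.dilate_mem_boundary 1 x hx⟩).symm
  · intro t a
    have hd : UnitBall.depth (t, a.1) = 0 := by
      have ha : ‖(a.1 : E)‖ = 1 := a.2
      ext
      simp [UnitBall.depth, ha, t.2.1]
    change V (UnitBall.depth (t, a.1), UnitBall.dilate (t, a.1)) = _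
    rw [hd, UnitBall.dilate_of_mem_boundary _ a.2]
    exact V.apply_zero _

end RelativeLifts

section WeakHomotopyEquivalences

variable {X Y : Type*} [TopologicalSpace X] [TopologicalSpace Y] {f : C(X, Y)}

/-- A homotopy from `f ∘ p` to `f ∘ q` is a map on the prism whose restriction to the boundary lifts
to `X`: by `p` and `q` on the two ends, and by their common values on the sides. Filling this lift
gives the homotopy upstairs. -/
theorem RelLift.homotopicRel {n : ℕ} (h : RelLift (prismIncl n) f) {p q : C(Fin n → I, X)}
    (hpq : ∀ y ∈ Cube.boundary (Fin n), p y = q y)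
    (H : (f.comp p).HomotopicRel (f.comp q) (Cube.boundary (Fin n))) :
    p.HomotopicRel q (Cube.boundary (Fin n)) := by
  obtain ⟨H⟩ := H
  -- The cut at 1/2 only separates the two ends: a boundary point at that height lies on a side,
  -- where `p` and `q` agree.
  have hc : Continuous fun z : prismBoundary n =>
      if (z.1.1 : ℝ) ≤ 1 / 2 then p z.1.2 else q z.1.2 := by
    refine Continuous.if_le (by fun_prop) (by fun_prop) (by fun_prop) (by fun_prop) ?_
    rintro ⟨⟨t, y⟩, hz⟩ ht
    refine hpq y ?_
    rcases hz with hz | hz | hz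
    · simp only at hz ht
      rw [hz] at ht
      norm_num at ht
    · simp only at hz ht
      rw [hz] at ht
      norm_num at ht
    · exact hz
  obtain ⟨w, hw, -⟩ := h ⟨_, hc⟩ H.toContinuousMap (by
    rintro ⟨⟨t, y⟩, hz⟩
    simp only [ContinuousMap.coe_mk, subsetIncl_apply]
    rcases hz with hz | hz | hz
    · simp only at hz
      subst hz
      rw [if_pos (by norm_num)]
      exact (H.apply_zero _).symm
    · simp only at hz
      subst hz
      rw [if_neg (by norm_num)]
      exact (H.apply_one _).symm
    · refine Eq.trans ?_ (H.eq_fst t hz).symm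
      split_ifs
      · rfl
      · rw [← hpq y hz]
        rfl)
  refine ⟨⟨⟨w, fun y => ?_, fun y => ?_⟩, fun t y hy => ?_⟩⟩
  · refine (hw ⟨(0, y), Or.inl rfl⟩).trans (if_pos ?_)
    norm_num
  · refine (hw ⟨(1, y), Or.inr (Or.inl rfl)⟩).trans (if_neg ?_)
    norm_num
  · refine (hw ⟨(t, y), Or.inr (Or.inr hy)⟩).trans ?_
    simp only [ContinuousMap.coe_mk]
    split_ifs
    · rfl
    · exact (hpq y hy).symm

/-- Cubes yield surjectivity and prisms injectivity. The case `n = 0`, where the cube is a point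
with empty boundary, handles path components. -/
theorem IsWeakHomotopyEquivalence.of_relLift (h₁ : ∀ n, RelLift (cubeIncl n) f)
    (h₂ : ∀ n, RelLift (prismIncl n) f) : IsWeakHomotopyEquivalence f where
  bijective_pathComponents := by
    constructor
    · intro a b
      induction a using ZerothHomotopy.rec with | mk x
      induction b using ZerothHomotopy.rec with | mk y
      intro hxy
      obtain ⟨γ⟩ : Joined (f x) (f y) := Quotient.exact hxy
      obtain ⟨H⟩ := (h₂ 0).homotopicRel (p := ContinuousMap.const _ x)
        (q := ContinuousMap.const _ y) (fun _ ⟨i, _⟩ => i.elim0)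
        ⟨⟨⟨⟨fun z => γ z.1, by fun_prop⟩, fun _ => γ.source, fun _ => γ.target⟩,
          fun _ _ ⟨i, _⟩ => i.elim0⟩⟩
      exact ZerothHomotopy.sound (H.toHomotopy.evalAt 0)
    · intro b
      induction b using ZerothHomotopy.rec with | mk y
      obtain ⟨w, -, H, -⟩ := h₁ 0 ⟨fun z => (z.2.choose).elim0,
        continuous_of_const fun z => (z.2.choose).elim0⟩ (ContinuousMap.const _ y)
        fun z => (z.2.choose).elim0
      exact ⟨ZerothHomotopy.mk (w 0), ZerothHomotopy.sound (H.evalAt 0).symm⟩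
  bijective_homotopyGroup := by
    intro n _ x
    constructor
    · intro a b
      induction a using Quotient.inductionOn with | h p
      induction b using Quotient.inductionOn with | h q
      intro hpq
      exact Quotient.sound ((h₂ n).homotopicRel (fun y hy => (p.2 y hy).trans (q.2 y hy).symm)
        (Quotient.exact hpq))
    · intro b
      induction b using Quotient.inductionOn with | h q
      obtain ⟨w, hw, H, hH⟩ := h₁ n (ContinuousMap.const _ x) q.1 fun z => (q.2 z z.2).symm
      refine ⟨Quotient.mk _ ⟨w, fun y hy => hw ⟨y, hy⟩⟩, Quotient.sound ?_⟩
      refine GenLoop.Homotopic.symm ⟨⟨H, fun t y hy => ?_⟩⟩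
      exact hH t ⟨y, hy⟩

theorem IsWeakHomotopyEquivalence.of_homotopyLift
    (h : ∀ n, HomotopyLift (sphereIncl (EuclideanSpace ℝ (Fin n))) f) :
    IsWeakHomotopyEquivalence f := by
  refine of_relLift (fun n => ?_) fun n => ?_
  · exact ((h n).of_retract (isArrowRetract_sphereIncl (by simp))).relLift.of_retract
      (isArrowRetract_cubeIncl n)
  · exact ((h (n + 1)).of_retract (isArrowRetract_sphereIncl
      (by simp [add_comm]))).relLift.of_retract (isArrowRetract_prismIncl n)

end WeakHomotopyEquivalences

/-! ### From weak homotopy equivalences to lifts up to homotopy -/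

namespace UnitBall

variable {F : Type*} [NormedAddCommGroup F]

/-- Twice the distance in the `ℓ¹`-norm to the center of the top face of the unit ball of
`ℝ × F`. -/
noncomputable def topDist (x : ℝ × F) : ℝ := 2 * (‖x.2‖ + 1 - x.1)

theorem topDist_nonneg (x : UnitBall (ℝ × F)) : 0 ≤ topDist (x : ℝ × F) := by
  have h : |x.1.1| ≤ 1 := (le_max_left _ _).trans x.norm_le
  have := (abs_le.1 h).2
  have := norm_nonneg x.1.2
  unfold topDist
  linarith

variable (F) in
/-- The center of the bottom face of the unit ball of `ℝ × F`. -/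
def bottom : UnitBall (ℝ × F) := ⟨(-1, 0), by simp⟩

variable (F) in
theorem bottom_mem_boundary : bottom F ∈ boundary (ℝ × F) := by
  simp [bottom, mem_boundary]

variable [NormedSpace ℝ F]

/-- The linear homotopy used for defining `UnitBall.collapse`. -/
noncomputable def collapseAux (p : ℝ × (ℝ × F)) : ℝ × F :=
  ((1 - p.1) * p.2.1 + p.1 * (1 - 2 * min 1 (topDist p.2)), (1 - p.1 * min 1 (topDist p.2)) • p.2.2)

/-- This is the denominator in `collapse`. If both summands vanished, then either `s = r = 1`, where
the first coordinate is -1, or `x` would be a pole `(±1, 0)`; but the linear homotopy fixes both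
poles. -/
theorem collapseAux_pos (s : I) (x : UnitBall (ℝ × F)) :
    0 < ‖collapseAux ((s : ℝ), (x : ℝ × F))‖ +
      (1 - ‖(x : ℝ × F)‖) * (1 - s * min 1 (topDist (x : ℝ × F))) := by
  obtain ⟨⟨t, y⟩, hx⟩ := x
  have hx' : ‖(t, y)‖ ≤ 1 := mem_closedBall_zero_iff.1 hx
  have hρ : 0 ≤ topDist (t, y) := topDist_nonneg ⟨(t, y), hx⟩
  obtain ⟨r, hr⟩ : ∃ r, r = min 1 (topDist (t, y)) := ⟨_, rfl⟩
  have hr₀ : 0 ≤ r := hr ▸ le_min zero_le_one hρ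
  have hr₁ : r ≤ 1 := hr ▸ min_le_left _ _
  simp only [← hr, collapseAux]
  have hsr : (s : ℝ) * r ≤ 1 := mul_le_one₀ s.2.2 hr₀ hr₁
  have h₁ : 0 ≤ (1 - ‖(t, y)‖) * (1 - s * r) := mul_nonneg (by linarith) (by linarith)
  refine lt_of_le_of_ne (add_nonneg (norm_nonneg _) h₁) fun h => ?_
  have hk := norm_nonneg (((1 - s) * t + s * (1 - 2 * r), (1 - s * r) • y) : ℝ × F)
  have hk₀ : (((1 - s) * t + s * (1 - 2 * r), (1 - s * r) • y) : ℝ × F) = 0 :=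
    norm_eq_zero.1 (by linarith)
  have h₂ : (1 - ‖(t, y)‖) * (1 - s * r) = 0 := by linarith
  have hk₁ : (1 - s) * t + s * (1 - 2 * r) = 0 := congrArg Prod.fst hk₀
  have hk₂ : (1 - (s : ℝ) * r) • y = 0 := congrArg Prod.snd hk₀
  by_cases hsr₁ : (s : ℝ) * r = 1
  · have hs : (s : ℝ) = 1 := le_antisymm s.2.2 (by nlinarith [s.2.1])
    rw [hs] at hk₁ hsr₁
    linarith
  · have hne : 1 - (s : ℝ) * r ≠ 0 := fun h => hsr₁ (by linarith)
    have hy : y = 0 := (smul_eq_zero.1 hk₂).resolve_left hne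
    have ht : ‖(t, y)‖ = 1 := by
      have := (mul_eq_zero.1 h₂).resolve_right hne
      linarith
    rw [hy, Prod.norm_mk, norm_zero, max_eq_left (norm_nonneg _), Real.norm_eq_abs,
      abs_eq zero_le_one] at ht
    have hρ' : topDist (t, y) = 2 * (1 - t) := by simp [topDist, hy]
    rcases ht with ht | ht
    · have : r = 0 := by rw [hr, hρ', ht]; norm_num
      rw [ht, this] at hk₁
      linarith
    · have : r = 1 := by rw [hr, hρ', ht]; norm_num
      rw [ht, this] at hk₁
      linarith

/-- A homotopy of the unit ball of `ℝ × F`, preserving the boundary, from the identity to a map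
which sends all faces but the top one to the center of the bottom face. -/
noncomputable def collapse : C(I × UnitBall (ℝ × F), UnitBall (ℝ × F)) where
  -- The correction term vanishes on the boundary, where the division is therefore the radial
  -- projection to the sphere. The denominator is 1 at time 0, and also at time 1 wherever `topDist`
  -- is at least 1.
  toFun p := ⟨(‖collapseAux ((p.1 : ℝ), (p.2 : ℝ × F))‖ +
      (1 - ‖(p.2 : ℝ × F)‖) * (1 - p.1 * min 1 (topDist (p.2 : ℝ × F))))⁻¹ •
        collapseAux ((p.1 : ℝ), (p.2 : ℝ × F)), by
    have h := collapseAux_pos p.1 p.2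
    rw [mem_closedBall_zero_iff, norm_smul, norm_inv, Real.norm_of_nonneg h.le, inv_mul_le_iff₀ h,
      mul_one, le_add_iff_nonneg_right]
    refine mul_nonneg (by linarith [p.2.norm_le]) ?_
    linarith [mul_le_one₀ p.1.2.2 (le_min zero_le_one (topDist_nonneg p.2)) (min_le_left _ _)]⟩
  continuous_toFun := by
    refine Continuous.subtype_mk (Continuous.smul (Continuous.inv₀ ?_ fun p : I × UnitBall (ℝ × F) =>
      (collapseAux_pos p.1 p.2).ne') ?_) _ <;> unfold collapseAux topDist <;> fun_prop

theorem collapse_mem_boundary (s : I) {x : UnitBall (ℝ × F)} (hx : x ∈ boundary (ℝ × F)) :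
    collapse (s, x) ∈ boundary (ℝ × F) := by
  have h := collapseAux_pos s x
  rw [mem_boundary] at hx ⊢
  simp only [hx, sub_self, zero_mul, add_zero] at h
  simp only [collapse, ContinuousMap.coe_mk, hx, sub_self, zero_mul, add_zero]
  rw [norm_smul, norm_inv, norm_norm, inv_mul_cancel₀ h.ne']

theorem collapse_zero (x : UnitBall (ℝ × F)) : collapse (0, x) = x := by
  ext1
  have h : collapseAux (((0 : I) : ℝ), (x : ℝ × F)) = x := by simp [collapseAux]
  simp only [collapse, ContinuousMap.coe_mk, h]
  simp

theorem collapse_one {x : UnitBall (ℝ × F)} (hx : 1 ≤ topDist (x : ℝ × F)) :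
    collapse (1, x) = bottom F := by
  ext1
  simp [collapse, collapseAux, bottom, min_eq_left hx]
  norm_num

variable {X Y : Type*} [TopologicalSpace X] [TopologicalSpace Y]

/-- The deformation has two stages. The collapse makes the square constant away from a small
neighbourhood of the center of the top face; then that constant value is dragged along `γ`, which
brings the other faces to the base point `x₀`. -/
theorem exists_squareHomotopic (f : C(X, Y)) (u : C(boundary (ℝ × F), X))
    (v : C(UnitBall (ℝ × F), Y)) (huv : ∀ a, f (u a) = v (sphereIncl _ a)) {x₀ : X}
    (γ : Path (u ⟨bottom F, bottom_mem_boundary F⟩) x₀) :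
    ∃ (u' : C(boundary (ℝ × F), X)) (v' : C(UnitBall (ℝ × F), Y)),
      SquareHomotopic (sphereIncl _) f u v u' v' ∧ (∀ a, f (u' a) = v' (sphereIncl _ a)) ∧
        ∀ a : boundary (ℝ × F), (a.1.1.1 = -1 ∨ ‖a.1.1.2‖ = 1) → u' a = x₀ := by
  have hγ : f (u ⟨bottom F, bottom_mem_boundary F⟩) = v (bottom F) := huv _
  let c : C(I × boundary (ℝ × F), boundary (ℝ × F)) :=
    ⟨fun p => ⟨collapse (p.1, p.2.1), collapse_mem_boundary p.1 p.2.2⟩, by fun_prop⟩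
  -- A ramp from 0 to 1 on the region where `topDist` goes from 1 to 2: the path `γ` is laid out
  -- there.
  let κ : C(UnitBall (ℝ × F), I) :=
    ⟨fun x => Set.projIcc 0 1 zero_le_one (topDist (x : ℝ × F) - 1), continuous_projIcc.comp
      (by unfold topDist; fun_prop)⟩
  have hκ₀ : ∀ x : UnitBall (ℝ × F), topDist (x : ℝ × F) ≤ 1 → κ x = 0 := fun x hx =>
    Set.projIcc_of_le_left zero_le_one (by linarith)
  have hκ₁ : ∀ x : UnitBall (ℝ × F), 2 ≤ topDist (x : ℝ × F) → κ x = 1 := fun x hx =>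
    Set.projIcc_of_right_le zero_le_one (by linarith)
  have htop : Continuous fun x : UnitBall (ℝ × F) => topDist (x : ℝ × F) := by
    unfold topDist; fun_prop
  -- The two formulas match where `topDist` is 1: the collapse has already reached the bottom
  -- center, and `γ` starts at its image.
  let V : C(I × UnitBall (ℝ × F), Y) :=
    ⟨fun p => if topDist (p.2 : ℝ × F) ≤ 1 then v (collapse (1, p.2)) else f (γ (p.1 * κ p.2)), by
      refine Continuous.if_le (by fun_prop) (by fun_prop) (htop.comp continuous_snd) (by fun_prop) ?_
      intro p hp
      rw [collapse_one hp.ge, hκ₀ _ hp.le, mul_zero, γ.source, hγ]⟩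
  let U : C(I × boundary (ℝ × F), X) :=
    ⟨fun p => if topDist (p.2.1 : ℝ × F) ≤ 1 then u (c (1, p.2)) else γ (p.1 * κ p.2.1), by
      refine Continuous.if_le (by fun_prop) (by fun_prop) (htop.comp (by fun_prop)) (by fun_prop) ?_
      intro p hp
      rw [hκ₀ _ hp.le, mul_zero, γ.source]
      exact congrArg u (Subtype.ext (collapse_one hp.ge))⟩
  have hUV : ∀ t a, f (U (t, a)) = V (t, sphereIncl _ a) := by
    intro t a
    simp only [U, V, ContinuousMap.coe_mk, subsetIncl_apply]
    split_ifs
    · exact huv _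
    · rfl
  refine ⟨⟨fun a => U (1, a), by fun_prop⟩, ⟨fun a => V (1, a), by fun_prop⟩,
    SquareHomotopic.trans (u₁ := ⟨fun a => U (0, a), by fun_prop⟩)
      (v₁ := ⟨fun a => V (0, a), by fun_prop⟩)
      ⟨⟨u.comp c, fun a => ?_, fun a => ?_⟩, ⟨v.comp collapse, fun a => ?_, fun a => ?_⟩, ?_⟩
      ⟨⟨U, fun _ => rfl, fun _ => rfl⟩, ⟨V, fun _ => rfl, fun _ => rfl⟩, hUV⟩, hUV 1, ?_⟩
  · exact congrArg u (Subtype.ext (collapse_zero _))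
  · change u (c (1, a)) = ite _ _ _
    split_ifs with h
    · rfl
    · rw [zero_mul, γ.source]
      exact congrArg u (Subtype.ext (collapse_one (not_le.1 h).le))
  · exact congrArg v (collapse_zero _)
  · change v (collapse (1, a)) = ite _ _ _
    split_ifs with h
    · rfl
    · rw [zero_mul, γ.source, hγ, collapse_one (not_le.1 h).le]
  · exact fun t a => huv _
  · intro a ha
    -- The factor 2 in `topDist` is chosen so that the ramp is finished before the sides are
    -- reached.
    have h₂ : 2 ≤ topDist (a.1 : ℝ × F) := by
      have h : |a.1.1.1| ≤ 1 := (le_max_left _ _).trans a.1.norm_le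
      have := (abs_le.1 h).2
      have := norm_nonneg a.1.1.2
      unfold topDist
      rcases ha with ha | ha <;> rw [ha] <;> linarith
    change ite _ _ _ = _
    rw [if_neg (by linarith), hκ₁ _ h₂, mul_one, γ.target]

end UnitBall

/-! ### Higher loops as paths in spaces of lower loops -/

section GenLoop

variable {X Y : Type*} [TopologicalSpace X] [TopologicalSpace Y] {n : ℕ}

/-- A family of maps `Iⁿ → X` which are constant on the boundary is a family of generalized
loops. -/
def GenLoop.family {T : Type*} [TopologicalSpace T] {x : X} (g : C(T × (Fin n → I), X))
    (hg : ∀ t, ∀ y ∈ Cube.boundary (Fin n), g (t, y) = x) : C(T, GenLoop (Fin n) X x) :=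
  ⟨fun t => ⟨g.curry t, hg t⟩, g.curry.continuous.subtype_mk _⟩

theorem continuous_genLoopMap (f : C(X, Y)) (n : ℕ) (x : X) : Continuous (genLoopMap f n x) :=
  ((ContinuousMap.continuous_postcomp f).comp continuous_subtype_val).subtype_mk _

theorem Cube.cons_mem_boundary {t : I} {y : Fin n → I}
    (h : t = 0 ∨ t = 1 ∨ y ∈ Cube.boundary (Fin n)) :
    (Fin.cons t y : Fin (n + 1) → I) ∈ Cube.boundary (Fin (n + 1)) := by
  rcases h with h | h | ⟨i, hi⟩
  · exact ⟨0, by simp [h]⟩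
  · exact ⟨0, by simp [h]⟩
  · exact ⟨i.succ, by simpa using hi⟩

theorem Cube.mem_boundary_succ {y : Fin (n + 1) → I} (h : y ∈ Cube.boundary (Fin (n + 1))) :
    y 0 = 0 ∨ y 0 = 1 ∨ Fin.tail y ∈ Cube.boundary (Fin n) := by
  obtain ⟨i, hi⟩ := h
  induction i using Fin.cases with
  | zero => exact or_assoc.1 (Or.inl hi)
  | succ i => exact Or.inr (Or.inr ⟨i, hi⟩)

/-- If `f` is surjective on `πₙ₊₁`, then it is surjective on the fundamental groups of the spaces
of `n`-dimensional loops. -/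
theorem exists_map_genLoopMap_homotopic (f : C(X, Y)) (x : X)
    (hf : Function.Surjective (homotopyGroupMap f (n + 1) x))
    (δ : Path (genLoopMap f n x GenLoop.const) (genLoopMap f n x GenLoop.const)) :
    ∃ θ : Path (GenLoop.const : GenLoop (Fin n) X x) GenLoop.const,
      (θ.map (continuous_genLoopMap f n x)).Homotopic δ := by
  -- The path `δ` is uncurried, its parameter becoming coordinate 0 of the cube; a class over it is
  -- then curried back.
  let q : GenLoop (Fin (n + 1)) Y (f x) := ⟨⟨fun y => δ (y 0) (Fin.tail y), by
    unfold Fin.tail; fun_prop⟩, fun y hy => by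
      simp only [ContinuousMap.coe_mk]
      rcases Cube.mem_boundary_succ hy with h | h | h
      · rw [h, δ.source]; rfl
      · rw [h, δ.target]; rfl
      · exact (δ (y 0)).2 _ h⟩
  obtain ⟨r, hr⟩ := hf (Quotient.mk _ q)
  induction r using Quotient.inductionOn with | h r
  obtain ⟨H⟩ : GenLoop.Homotopic (genLoopMap f (n + 1) x r) q := Quotient.exact hr
  have hcons : Continuous fun p : I × (Fin n → I) => (Fin.cons p.1 p.2 : Fin (n + 1) → I) :=
    continuous_pi fun i => by
      induction i using Fin.cases with
      | zero => simpa using continuous_fst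
      | succ i => simpa using (continuous_apply i).comp' continuous_snd
  let θ : C(I, GenLoop (Fin n) X x) := GenLoop.family (r.1.comp ⟨_, hcons⟩)
    fun t y hy => r.2 _ (Cube.cons_mem_boundary (Or.inr (Or.inr hy)))
  let K : C(I × I, GenLoop (Fin n) Y (f x)) := GenLoop.family
    (H.toContinuousMap.comp ⟨fun p : (I × I) × (Fin n → I) =>
      (p.1.1, (Fin.cons p.1.2 p.2 : Fin (n + 1) → I)), by
        exact (continuous_fst.fst).prodMk (hcons.comp (continuous_fst.snd.prodMk continuous_snd))⟩)
    fun t y hy => (H.eq_fst t.1 (Cube.cons_mem_boundary (Or.inr (Or.inr hy)))).trans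
      ((genLoopMap f (n + 1) x r).2 _ (Cube.cons_mem_boundary (Or.inr (Or.inr hy))))
  have hK₀ : ∀ t, K (0, t) = genLoopMap f n x (θ t) := fun t => GenLoop.ext _ _ fun y =>
    H.apply_zero _
  have hK₁ : ∀ t, K (1, t) = δ t := fun t => GenLoop.ext _ _ fun y => by
    refine (H.apply_one _).trans ?_
    simp [q]
  have hK : ∀ s t, (t = 0 ∨ t = 1) → K (s, t) = genLoopMap f n x (θ t) := fun s t ht =>
    GenLoop.ext _ _ fun y => H.eq_fst s (Cube.cons_mem_boundary (or_assoc.1 (Or.inl ht)))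
  refine ⟨⟨θ, ?_, ?_⟩, ⟨⟨⟨K, hK₀, hK₁⟩, fun s t ht => hK s t ?_⟩⟩⟩
  · exact GenLoop.ext _ _ fun y => r.2 _ (Cube.cons_mem_boundary (Or.inl rfl))
  · exact GenLoop.ext _ _ fun y => r.2 _ (Cube.cons_mem_boundary (Or.inr (Or.inl rfl)))
  · simpa using ht

end GenLoop

section WeakHomotopyEquivalences

variable {X Y : Type*} [TopologicalSpace X] [TopologicalSpace Y]

/-- The only nontrivial face of `u` is a loop `p`, and `v` is a path `β` in the loop space of `Y`
from the constant loop to the image of `p`. A lift is a path from the constant loop to `p` whose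
image is homotopic to `β`. Injectivity on `πₙ` supplies some path `α`, and surjectivity on `πₙ₊₁`
corrects it by a loop `θ`. -/
theorem exists_relLift_prism (f : C(X, Y)) {n : ℕ} (x : X)
    (hinj : ∀ p q : GenLoop (Fin n) X x,
      GenLoop.Homotopic (genLoopMap f n x p) (genLoopMap f n x q) → GenLoop.Homotopic p q)
    (hsurj : Function.Surjective (homotopyGroupMap f (n + 1) x))
    (u : C(prismBoundary n, X)) (v : C(I × (Fin n → I), Y)) (huv : ∀ a, f (u a) = v a)
    (hu : ∀ a : prismBoundary n, (a.1.1 = 0 ∨ a.1.2 ∈ Cube.boundary (Fin n)) → u a = x) :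
    ∃ w : C(I × (Fin n → I), X), (∀ a : prismBoundary n, w a = u a) ∧
      ∃ H : v.Homotopy (f.comp w), ∀ t, ∀ a : prismBoundary n, H (t, a) = v a := by
  let F := continuous_genLoopMap f n x
  let p : GenLoop (Fin n) X x := ⟨⟨fun y => u ⟨(1, y), Or.inr (Or.inl rfl)⟩, by fun_prop⟩,
    fun y hy => hu _ (Or.inr hy)⟩
  have hv : ∀ t, ∀ y ∈ Cube.boundary (Fin n), v (t, y) = f x := fun t y hy => by
    rw [← hu ⟨(t, y), Or.inr (Or.inr hy)⟩ (Or.inr hy), huv]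
  have hv₀ : ∀ y, v (0, y) = f x := fun y => by
    rw [← hu ⟨(0, y), Or.inl rfl⟩ (Or.inl rfl), huv]
  let β : Path (genLoopMap f n x GenLoop.const) (genLoopMap f n x p) :=
    ⟨GenLoop.family v hv, GenLoop.ext _ _ hv₀, GenLoop.ext _ _ fun y => (huv ⟨(1, y), Or.inr (Or.inl rfl)⟩).symm⟩
  obtain ⟨K⟩ := hinj GenLoop.const p ⟨⟨⟨v, hv₀, fun y => (huv ⟨(1, y), Or.inr (Or.inl rfl)⟩).symm⟩,
    fun t y hy => hv t y hy⟩⟩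
  let α : Path (GenLoop.const : GenLoop (Fin n) X x) p :=
    ⟨GenLoop.family K.toContinuousMap fun t y hy => K.eq_fst t hy,
      GenLoop.ext _ _ fun y => K.apply_zero y, GenLoop.ext _ _ fun y => K.apply_one y⟩
  -- The loop `β · (f α)⁻¹` measures the failure of `α` to lift `β`; once it is lifted to `θ`, the
  -- path `θ · α` has the right image up to homotopy.
  obtain ⟨θ, hθ⟩ := exists_map_genLoopMap_homotopic f x hsurj (β.trans (α.map F).symm)
  have hw : β.Homotopic ((θ.trans α).map F) := by
    rw [← Path.Homotopic.Quotient.eq] at hθ ⊢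
    rw [Path.map_trans, Path.Homotopic.Quotient.mk_trans, hθ, ← Path.Homotopic.Quotient.mk_trans,
      Path.Homotopic.Quotient.eq]
    refine Path.Homotopic.trans ?_ (Path.Homotopic.symm ⟨Path.Homotopy.transAssoc _ _ _⟩)
    refine Path.Homotopic.trans (Path.Homotopic.symm ⟨Path.Homotopy.transRefl β⟩) ?_
    exact Path.Homotopic.hcomp (.refl _) ⟨Path.Homotopy.reflSymmTrans _⟩
  obtain ⟨H⟩ := hw
  let w : C(I × (Fin n → I), X) := ⟨fun z => θ.trans α z.1 z.2, by fun_prop⟩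
  refine ⟨w, ?_, ⟨⟨fun z => H (z.1, z.2.1) z.2.2, by fun_prop⟩, fun z => ?_, fun z => ?_⟩, ?_⟩
  · rintro ⟨⟨t, y⟩, ht | ht | hy⟩
    · simp only at ht
      subst ht
      refine (congrArg (fun r : GenLoop (Fin n) X x => r y) (θ.trans α).source).trans ?_
      exact (hu _ (Or.inl rfl)).symm
    · simp only at ht
      subst ht
      exact congrArg (fun r : GenLoop (Fin n) X x => r y) (θ.trans α).target
    · exact ((θ.trans α t).2 y hy).trans (hu _ (Or.inr hy)).symm
  · exact congrArg (fun r : GenLoop (Fin n) Y (f x) => r z.2) (H.apply_zero z.1)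
  · exact congrArg (fun r : GenLoop (Fin n) Y (f x) => r z.2) (H.apply_one z.1)
  · rintro s ⟨⟨t, y⟩, ht | ht | hy⟩
    · exact congrArg (fun r : GenLoop (Fin n) Y (f x) => r y) (H.eq_fst s (Or.inl ht))
    · exact congrArg (fun r : GenLoop (Fin n) Y (f x) => r y)
        (H.eq_fst s (Or.inr (Set.mem_singleton_iff.2 ht)))
    · exact ((H (s, t)).2 y hy).trans (hv t y hy).symm

/-- The condition on homotopy groups is asked at only one base point in each path component, since
the square can be moved along a path. This weak form is what two-out-of-three requires. -/
theorem homotopyLift_of_bijective (f : C(X, Y)) (h₀ : Function.Bijective (pathComponentsMap f))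
    (h : ∀ x : X, ∃ x₀, Joined x x₀ ∧ ∀ n, 1 ≤ n → Function.Bijective (homotopyGroupMap f n x₀))
    (n : ℕ) : HomotopyLift (sphereIncl (EuclideanSpace ℝ (Fin n))) f := by
  cases n with
  | zero =>
    have hE : IsEmpty (UnitBall.boundary (EuclideanSpace ℝ (Fin 0))) :=
      ⟨fun a => by
        have := a.2
        rw [UnitBall.mem_boundary, Subsingleton.elim (a.1.1) 0, norm_zero] at this
        exact zero_ne_one this⟩
    have : Unique (UnitBall (EuclideanSpace ℝ (Fin 0))) :=
      ⟨⟨⟨0, by simp⟩⟩, fun _ => Subtype.ext (Subsingleton.elim _ _)⟩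
    intro u v _
    obtain ⟨a, ha⟩ := h₀.2 (ZerothHomotopy.mk (v default))
    induction a using ZerothHomotopy.rec with | mk x
    obtain ⟨γ⟩ : Joined (f x) (v default) := Quotient.exact ha
    refine ⟨ContinuousMap.const _ x, (ContinuousMap.Homotopy.refl u).cast rfl
      (ContinuousMap.ext fun a => hE.elim a), ⟨⟨fun z => γ.symm z.1, by fun_prop⟩,
      fun z => ?_, fun z => γ.symm.target⟩, fun _ a => hE.elim a⟩
    rw [Unique.eq_default z]
    exact γ.symm.source
  | succ n =>
    refine HomotopyLift.of_retract (j := sphereIncl (ℝ × (Fin n → ℝ))) ?_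
      (isArrowRetract_sphereIncl (by simp [add_comm]))
    intro u v huv
    obtain ⟨x₀, ⟨γ⟩, hx₀⟩ := h (u ⟨_, UnitBall.bottom_mem_boundary _⟩)
    obtain ⟨u', v', hsq, huv', hu'⟩ := UnitBall.exists_squareHomotopic f u v huv γ
    let g := prismHomeomorph n
    let g₀ : C(prismBoundary n, UnitBall.boundary (ℝ × (Fin n → ℝ))) :=
      ⟨fun a => ⟨g a.1, (prismHomeomorph_mem_boundary _).2 a.2⟩, by fun_prop⟩
    have hinj : ∀ p q : GenLoop (Fin n) X x₀, GenLoop.Homotopic (genLoopMap f n x₀ p)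
        (genLoopMap f n x₀ q) → GenLoop.Homotopic p q := by
      -- In dimension 0 generalized loops are points, so the injectivity needed is that on path
      -- components.
      cases n with
      | zero =>
        intro p q hpq
        obtain ⟨K⟩ := hpq
        obtain ⟨δ⟩ : Joined (p 0) (q 0) := by
          have := @h₀.1 (ZerothHomotopy.mk (p 0)) (ZerothHomotopy.mk (q 0))
            (ZerothHomotopy.sound (K.toHomotopy.evalAt 0))
          exact Quotient.exact this
        refine ⟨⟨⟨fun z => δ z.1, by fun_prop⟩, fun z => ?_, fun z => ?_⟩, fun _ _ ⟨i, _⟩ => i.elim0⟩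
        · exact δ.source.trans (congrArg p (Subsingleton.elim _ _))
        · exact δ.target.trans (congrArg q (Subsingleton.elim _ _))
      | succ n =>
        intro p q hpq
        exact Quotient.exact ((hx₀ (n + 1) (by omega)).1
          (Quotient.sound hpq : homotopyGroupMap f (n + 1) x₀ (Quotient.mk _ p) =
            homotopyGroupMap f (n + 1) x₀ (Quotient.mk _ q)))
    obtain ⟨w, hw, H, hH⟩ := exists_relLift_prism f x₀ (n := n) hinj (hx₀ (n + 1) (by omega)).2
      (u'.comp g₀) (v'.comp g) (fun a => huv' _) (by
        rintro a (ha | ha)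
        · refine hu' _ (Or.inl ?_)
          change 2 * (a.1.1 : ℝ) - 1 = -1
          rw [ha]
          simp
        · exact hu' _ (Or.inr ((cubeHomeomorph_mem_boundary _).2 ha)))
    have hg : ∀ a : UnitBall.boundary (ℝ × (Fin n → ℝ)), g.symm a.1 ∈ prismBoundary n :=
      fun a => (prismHomeomorph_mem_boundary _).1 (by
        change g (g.symm a.1) ∈ _
        rw [g.apply_symm_apply]
        exact a.2)
    have hg' : ∀ a : UnitBall.boundary (ℝ × (Fin n → ℝ)), g₀ ⟨g.symm a.1, hg a⟩ = a :=
      fun a => Subtype.ext (g.apply_symm_apply _)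
    refine ⟨w.comp g.symm, hsq.trans ⟨(ContinuousMap.Homotopy.refl u').cast rfl ?_,
      (H.compContinuousMap g.symm).cast ?_ ?_, fun t a => ?_⟩⟩
    · ext a
      refine Eq.trans ?_ (hw ⟨g.symm a.1, hg a⟩).symm
      exact congrArg u' (hg' a).symm
    · ext a
      simp
    · rfl
    · refine Eq.trans ?_ (hH t ⟨g.symm a.1, hg a⟩).symm
      refine (huv' a).trans (congrArg v' ?_)
      exact (g.apply_symm_apply _).symm

theorem isWeakHomotopyEquivalence_iff_homotopyLift {f : C(X, Y)} :
    IsWeakHomotopyEquivalence f ↔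
      ∀ n, HomotopyLift (sphereIncl (EuclideanSpace ℝ (Fin n))) f :=
  ⟨fun h => homotopyLift_of_bijective f h.1 fun x => ⟨x, .refl x, fun n hn => h.2 n hn x⟩,
    IsWeakHomotopyEquivalence.of_homotopyLift⟩

/-! ### The two-out-of-three property -/

variable {Z : Type*} [TopologicalSpace Z] {f : C(X, Y)} {g : C(Y, Z)}

theorem pathComponentsMap_comp :
    pathComponentsMap (g.comp f) = pathComponentsMap g ∘ pathComponentsMap f := by
  ext a
  induction a using ZerothHomotopy.rec with | mk x
  rfl

theorem homotopyGroupMap_comp (n : ℕ) (x : X) :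
    homotopyGroupMap (g.comp f) n x = homotopyGroupMap g n (f x) ∘ homotopyGroupMap f n x := by
  ext a
  induction a using Quotient.inductionOn with | h p
  rfl

theorem IsWeakHomotopyEquivalence.comp (hf : IsWeakHomotopyEquivalence f)
    (hg : IsWeakHomotopyEquivalence g) : IsWeakHomotopyEquivalence (g.comp f) where
  bijective_pathComponents := by
    rw [pathComponentsMap_comp]
    exact hg.1.comp hf.1
  bijective_homotopyGroup n hn x := by
    rw [homotopyGroupMap_comp]
    exact (hg.2 n hn _).comp (hf.2 n hn x)

theorem IsWeakHomotopyEquivalence.of_postcomp (hg : IsWeakHomotopyEquivalence g)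
    (hgf : IsWeakHomotopyEquivalence (g.comp f)) : IsWeakHomotopyEquivalence f where
  bijective_pathComponents := by
    have := hgf.1
    rw [pathComponentsMap_comp] at this
    exact (Function.Bijective.of_comp_iff' hg.1 _).1 this
  bijective_homotopyGroup n hn x := by
    have := hgf.2 n hn x
    rw [homotopyGroupMap_comp] at this
    exact (Function.Bijective.of_comp_iff' (hg.2 n hn _) _).1 this

/-- The hypotheses control `g` only at base points of the form `f x`, but these meet every path
component of `Y`. -/
theorem IsWeakHomotopyEquivalence.of_precomp (hf : IsWeakHomotopyEquivalence f)
    (hgf : IsWeakHomotopyEquivalence (g.comp f)) : IsWeakHomotopyEquivalence g := by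
  refine .of_homotopyLift (homotopyLift_of_bijective g ?_ fun y => ?_)
  · have := hgf.1
    rw [pathComponentsMap_comp] at this
    exact (Function.Bijective.of_comp_iff _ hf.1).1 this
  · obtain ⟨a, ha⟩ := hf.1.2 (ZerothHomotopy.mk y)
    induction a using ZerothHomotopy.rec with | mk x
    refine ⟨f x, Joined.symm (Quotient.exact ha), fun n hn => ?_⟩
    have := hgf.2 n hn x
    rw [homotopyGroupMap_comp] at this
    exact (Function.Bijective.of_comp_iff _ (hf.2 n hn x)).1 this

end WeakHomotopyEquivalences

/-! ### Serre fibrations -/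

section SerreFibrations

/-- The inclusion of `B` as the bottom of the cylinder `B × I`. -/
def bottomIncl (B : Type*) [TopologicalSpace B] : C(B, B × I) := ⟨fun b => (b, 0), by fun_prop⟩

theorem isArrowRetract_bottomIncl {B B' : Type*} [TopologicalSpace B] [TopologicalSpace B']
    (s : C(B, B')) (r : C(B', B)) (h : ∀ b, r (s b) = b) :
    IsArrowRetract (bottomIncl B) (bottomIncl B') :=
  ⟨s, s.prodMap (.id I), r, r.prodMap (.id I), fun _ => rfl, fun _ => rfl, h,
    fun b => Prod.ext (h b.1) rfl⟩

section

variable (F : Type*) [NormedAddCommGroup F]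

/-- All the faces of the unit ball of `ℝ × F` but the top one. -/
def boxFaces : Set (UnitBall (ℝ × F)) := {x | x.1.1 = -1 ∨ ‖x.1.2‖ = 1}

/-- The inclusion in the unit ball of `ℝ × F` of all the faces but the top one. -/
abbrev boxIncl : C(boxFaces F, UnitBall (ℝ × F)) := subsetIncl (boxFaces F)

variable {F}

theorem UnitBall.abs_fst_le (x : UnitBall (ℝ × F)) : |x.1.1| ≤ 1 :=
  (le_max_left _ _).trans x.norm_le

theorem UnitBall.norm_snd_le (x : UnitBall (ℝ × F)) : ‖x.1.2‖ ≤ 1 :=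
  (le_max_right _ _).trans x.norm_le

/-- A point of the unit ball of `ℝ × F`. -/
def UnitBall.pair (t : ℝ) (x : F) (ht : |t| ≤ 1) (hx : ‖x‖ ≤ 1) : UnitBall (ℝ × F) :=
  ⟨(t, x), mem_closedBall_zero_iff.2 (max_le ht hx)⟩

theorem UnitBall.continuous_pair {T : Type*} [TopologicalSpace T] {t : T → ℝ} {x : T → F}
    (h₁ : ∀ z, |t z| ≤ 1) (h₂ : ∀ z, ‖x z‖ ≤ 1) (ht : Continuous t) (hx : Continuous x) :
    Continuous fun z => UnitBall.pair (t z) (x z) (h₁ z) (h₂ z) :=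
  (ht.prodMk hx).subtype_mk _

theorem boxFaces_subset : boxFaces F ⊆ UnitBall.boundary (ℝ × F) := by
  intro x hx
  refine le_antisymm x.norm_le ?_
  rcases hx with hx | hx
  · refine le_trans (le_of_eq ?_) (le_max_left _ _)
    rw [hx]
    simp
  · exact hx.symm.le.trans (le_max_right _ _)

section

variable {X Y : Type*} [TopologicalSpace X] [TopologicalSpace Y] {f : C(X, Y)}

/-- The ball is obtained from the box by attaching two cells: first the top face along its boundary,
then the interior. -/
theorem StrictLift.box (h₁ : StrictLift (sphereIncl F) f)
    (h₂ : StrictLift (sphereIncl (ℝ × F)) f) : StrictLift (boxIncl F) f := by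
  intro u v huv
  let top : C(UnitBall F, UnitBall (ℝ × F)) :=
    ⟨fun y => UnitBall.pair 1 y abs_one.le y.norm_le,
      UnitBall.continuous_pair (t := fun _ => 1) (fun _ => abs_one.le) UnitBall.norm_le
        (by fun_prop) (by fun_prop)⟩
  let snd : C(UnitBall (ℝ × F), UnitBall F) :=
    ⟨fun x => ⟨x.1.2, mem_closedBall_zero_iff.2 x.norm_snd_le⟩, by fun_prop⟩
  have htop : ∀ x : UnitBall (ℝ × F), x.1.1 = 1 → top (snd x) = x := fun x hx =>
    Subtype.ext (Prod.ext hx.symm rfl)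
  obtain ⟨w, hw, hw'⟩ := h₁ ⟨fun y => u ⟨top y, Or.inr y.2⟩, by fun_prop⟩ (v.comp top)
    fun y => huv _
  obtain ⟨u', hu, hu'⟩ := exists_continuousMap_glue
    (P := {a : UnitBall.boundary (ℝ × F) | a.1 ∈ boxFaces F})
    (Q := {a : UnitBall.boundary (ℝ × F) | a.1.1.1 = 1})
    (IsClosed.union (isClosed_eq (by fun_prop) (by fun_prop))
      (isClosed_eq (by fun_prop) (by fun_prop)))
    (isClosed_eq (by fun_prop) (by fun_prop)) (fun a => by
      have ha : max |a.1.1.1| ‖a.1.1.2‖ = 1 := a.2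
      rcases max_choice |a.1.1.1| ‖a.1.1.2‖ with h | h
      · rw [h, abs_eq zero_le_one] at ha
        exact ha.symm.imp_left Or.inl
      · exact Or.inl (Or.inr (h.symm.trans ha)))
    (u.comp ⟨fun a => ⟨a.1.1, a.2⟩, by fun_prop⟩)
    (w.comp ⟨fun a => snd a.1.1, by fun_prop⟩) (fun a ha ha' => by
      have hs : snd a.1 ∈ UnitBall.boundary F := by
        rcases ha with ha | ha
        · change a.1.1.1 = 1 at ha'
          rw [ha'] at ha
          norm_num at ha
        · exact ha
      refine Eq.trans (congrArg u (Subtype.ext ?_)) (hw ⟨snd a.1, hs⟩).symm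
      exact (htop a.1 ha').symm)
  obtain ⟨w', hw₁, hw₂⟩ := h₂ u' v (fun a => by
    by_cases ha : a.1 ∈ boxFaces F
    · rw [hu a ha]
      exact huv ⟨a.1, ha⟩
    · have ha' : a.1.1.1 = 1 := by
        have ha₂ : max |a.1.1.1| ‖a.1.1.2‖ = 1 := a.2
        rcases max_choice |a.1.1.1| ‖a.1.1.2‖ with h | h
        · rw [h, abs_eq zero_le_one] at ha₂
          exact ha₂.resolve_right fun h => ha (Or.inl h)
        · exact absurd (Or.inr (h.symm.trans ha₂)) ha
      rw [hu' a ha']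
      exact (hw' _).trans (congrArg v (htop a.1 ha')))
  refine ⟨w', fun a => ?_, hw₂⟩
  exact (hw₁ ⟨a.1, boxFaces_subset a.2⟩).trans (hu ⟨a.1, boxFaces_subset a.2⟩ a.2)

/-- The homotopy of squares is regarded as a box problem: the bottom carries the lift `w` of the
deformed square, the sides carry `U`. The top face of a solution lifts the original square. -/
theorem StrictLift.of_homotopyLift (h₁ : StrictLift (boxIncl F) f)
    (h₂ : HomotopyLift (sphereIncl F) f) : StrictLift (sphereIncl F) f := by
  intro u v huv
  obtain ⟨w, U, V, hUV⟩ := h₂ u v huv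
  let snd : C(UnitBall (ℝ × F), UnitBall F) :=
    ⟨fun x => ⟨x.1.2, mem_closedBall_zero_iff.2 x.norm_snd_le⟩, by fun_prop⟩
  -- Time runs downwards: the original square sits on the missing top face, the one with a lift on
  -- the bottom.
  let time : C(UnitBall (ℝ × F), I) := ⟨fun x => ⟨(1 - x.1.1) / 2, by
    have := abs_le.1 x.abs_fst_le
    constructor <;> linarith⟩, by fun_prop⟩
  have htime : ∀ x : UnitBall (ℝ × F), x.1.1 = -1 → time x = 1 := fun x hx => by
    ext
    simp only [time, ContinuousMap.coe_mk, hx]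
    norm_num
  obtain ⟨u', hu, hu'⟩ := exists_continuousMap_glue
    (P := {a : boxFaces F | a.1.1.1 = -1}) (Q := {a : boxFaces F | ‖a.1.1.2‖ = 1})
    (isClosed_eq (by fun_prop) (by fun_prop)) (isClosed_eq (by fun_prop) (by fun_prop))
    (fun a => a.2) (w.comp ⟨fun a => snd a.1.1, by fun_prop⟩)
    (U.toContinuousMap.comp ⟨fun a => (time a.1.1, ⟨snd a.1.1, a.2⟩), by fun_prop⟩)
    (fun a ha ha' => by
      change _ = U (time a.1, ⟨snd a.1, _⟩)
      rw [htime a.1 ha]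
      exact (U.apply_one ⟨snd a.1, ha'⟩).symm)
  obtain ⟨w', hw₁, hw₂⟩ := h₁ u' (V.toContinuousMap.comp ⟨fun x => (time x, snd x), by fun_prop⟩)
    (fun a => by
      rcases a.2 with ha | ha
      · rw [hu a ha]
        change _ = V (time a.1, snd a.1)
        rw [htime a.1 ha]
        exact (V.apply_one _).symm
      · rw [hu' a ha]
        exact hUV _ ⟨snd a.1, ha⟩)
  let top : C(UnitBall F, UnitBall (ℝ × F)) :=
    ⟨fun y => UnitBall.pair 1 y abs_one.le y.norm_le,
      UnitBall.continuous_pair (t := fun _ => 1) (fun _ => abs_one.le) UnitBall.norm_le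
        (by fun_prop) (by fun_prop)⟩
  have htop : ∀ y, time (top y) = 0 := fun y => by
    ext
    simp [time, top, UnitBall.pair]
  refine ⟨w'.comp top, fun a => ?_, fun b => ?_⟩
  · refine (hw₁ ⟨top a, Or.inr a.2⟩).trans ((hu' _ a.2).trans ?_)
    change U (time (top a), a) = u a
    rw [htop]
    exact U.apply_zero a
  · refine (hw₂ (top b)).trans ?_
    change V (time (top b), b) = v b
    rw [htop]
    exact V.apply_zero b

end

/-- The gauge of the side and bottom faces of the unit ball of `ℝ × F`, centered at `(3, 0)`. -/
noncomputable def boxGauge (x : ℝ × F) : ℝ := max ((3 - x.1) / 4) ‖x.2‖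

theorem boxGauge_pos (x : UnitBall (ℝ × F)) : 0 < boxGauge (x : ℝ × F) := by
  have := (abs_le.1 x.abs_fst_le).2
  exact lt_max_of_lt_left (by linarith)

theorem boxGauge_le_one (x : UnitBall (ℝ × F)) : boxGauge (x : ℝ × F) ≤ 1 := by
  have := (abs_le.1 x.abs_fst_le).1
  exact max_le (by linarith) x.norm_snd_le

theorem boxGauge_eq_one {x : UnitBall (ℝ × F)} (hx : x ∈ boxFaces F) :
    boxGauge (x : ℝ × F) = 1 := by
  refine le_antisymm (boxGauge_le_one x) ?_
  rcases hx with hx | hx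
  · refine le_trans (le_of_eq ?_) (le_max_left _ _)
    rw [hx]
    norm_num
  · exact hx.symm.le.trans (le_max_right _ _)

variable [NormedSpace ℝ F]

/-- The homotopy pushing the unit ball of `ℝ × F` away from `(3, 0)`, onto the side and
bottom faces. -/
noncomputable def boxPush : C(UnitBall (ℝ × F) × I, UnitBall (ℝ × F)) where
  toFun p := UnitBall.pair (3 - (min 1 (boxGauge (p.1 : ℝ × F) + p.2))⁻¹ * (3 - p.1.1.1))
    ((min 1 (boxGauge (p.1 : ℝ × F) + p.2))⁻¹ • p.1.1.2) (by
      have h₀ := boxGauge_pos p.1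
      have h₁ := boxGauge_le_one p.1
      have h₂ := p.2.2.1
      have h₃ := abs_le.1 p.1.abs_fst_le
      have hm : 0 < min 1 (boxGauge (p.1 : ℝ × F) + p.2) := lt_min one_pos (by linarith)
      -- This bound keeps the pushed point above the bottom face; it stays below the top one because
      -- the scaling factor is at least 1 and its center `(3, 0)` lies above the ball.
      have hg : (3 - p.1.1.1) / 4 ≤ min 1 (boxGauge (p.1 : ℝ × F) + p.2) :=
        le_min ((le_max_left _ _).trans h₁) ((le_max_left _ _).trans (by
          change boxGauge _ ≤ _; linarith))
      rw [abs_le]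
      constructor
      · have : (min 1 (boxGauge (p.1 : ℝ × F) + p.2))⁻¹ * (3 - p.1.1.1) ≤ 4 := by
          rw [inv_mul_le_iff₀ hm]; linarith
        linarith
      · have : 1 * (3 - p.1.1.1) ≤ (min 1 (boxGauge (p.1 : ℝ × F) + p.2))⁻¹ * (3 - p.1.1.1) :=
          mul_le_mul_of_nonneg_right ((one_le_inv₀ hm).2 (min_le_left _ _)) (by linarith)
        linarith) (by
      have h₀ := boxGauge_pos p.1
      have h₁ := boxGauge_le_one p.1
      have h₂ := p.2.2.1
      have hm : 0 < min 1 (boxGauge (p.1 : ℝ × F) + p.2) := lt_min one_pos (by linarith)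
      rw [norm_smul, norm_inv, Real.norm_of_nonneg hm.le, inv_mul_le_iff₀ hm, mul_one]
      exact le_min p.1.norm_snd_le ((le_max_right _ _).trans (by
          change boxGauge _ ≤ _; linarith)))
  continuous_toFun := by
    have h : Continuous fun p : UnitBall (ℝ × F) × I =>
        (min 1 (boxGauge (p.1 : ℝ × F) + p.2))⁻¹ := by
      refine Continuous.inv₀ (by unfold boxGauge; fun_prop) fun p => ?_
      exact (lt_min one_pos (add_pos_of_pos_of_nonneg (boxGauge_pos p.1) p.2.2.1)).ne'
    refine Continuous.subtype_mk (Continuous.prodMk ?_ ?_) _ <;> fun_prop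

theorem boxPush_of_le {x : UnitBall (ℝ × F)} {s : I} (h : 1 ≤ boxGauge (x : ℝ × F) + s) :
    boxPush (x, s) = x := by
  ext1
  simp only [boxPush, ContinuousMap.coe_mk, UnitBall.pair, min_eq_left h]
  simp

theorem boxPush_zero_mem (x : UnitBall (ℝ × F)) : boxPush (x, 0) ∈ boxFaces F := by
  have h₀ := boxGauge_pos x
  have h₁ := boxGauge_le_one x
  simp only [boxFaces, Set.mem_ofPred_eq, boxPush, ContinuousMap.coe_mk, UnitBall.pair,
    Set.Icc.coe_zero, add_zero, min_eq_right h₁]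
  rcases max_choice ((3 - x.1.1) / 4) ‖x.1.2‖ with h | h
  · left
    change boxGauge _ = _ at h
    rw [h] at h₀ ⊢
    rw [inv_mul_eq_div, div_div_cancel₀ (by linarith)]
    norm_num
  · right
    change boxGauge _ = _ at h
    rw [h] at h₀ ⊢
    rw [norm_smul, norm_inv, norm_norm, inv_mul_cancel₀ h₀.ne']

/-- The section sends `x` to height `1 - boxGauge x`, the first time at which pushing fixes `x`.
Points of the box have gauge 1, so they stay at height 0. -/
theorem isArrowRetract_boxIncl :
    IsArrowRetract (boxIncl F) (bottomIncl (UnitBall (ℝ × F))) := by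
  refine ⟨subsetIncl _, ⟨fun x => (x, ⟨1 - boxGauge (x : ℝ × F),
    by linarith [boxGauge_le_one x], by linarith [boxGauge_pos x]⟩), by unfold boxGauge; fun_prop⟩,
    ⟨fun x => ⟨boxPush (x, 0), boxPush_zero_mem x⟩, by fun_prop⟩, boxPush, ?_, fun _ => rfl,
    ?_, ?_⟩
  · intro a
    refine Prod.ext rfl (Subtype.ext ?_)
    simp [bottomIncl, boxGauge_eq_one a.2]
  · intro a
    refine Subtype.ext (boxPush_of_le ?_)
    simp [boxGauge_eq_one a.2]
  · intro b
    refine boxPush_of_le ?_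
    simp

/-- The cylinder is embedded in the ball of `ℝ × F` over the half-size base. Doubling the base, with
truncation, retracts it, provided the height is also forced down to 0 on the sides. -/
theorem isArrowRetract_bottomIncl_boxIncl :
    IsArrowRetract (bottomIncl (UnitBall F)) (boxIncl F) := by
  have hhalf : ∀ x : UnitBall F, ‖(2⁻¹ : ℝ) • (x : F)‖ ≤ 2⁻¹ := fun x => by
    rw [norm_smul, norm_inv, Real.norm_two]
    linarith [x.norm_le]
  let s : C(UnitBall F × I, UnitBall (ℝ × F)) :=
    ⟨fun p => UnitBall.pair (2 * (p.2 : ℝ) - 1) ((2⁻¹ : ℝ) • (p.1 : F))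
      (abs_two_mul_sub_one_le _) ((hhalf _).trans (by norm_num)), by unfold UnitBall.pair; fun_prop⟩
  let d : C(UnitBall (ℝ × F), UnitBall F) :=
    ⟨fun x => UnitBall.dilate ((1 : I), ⟨x.1.2, mem_closedBall_zero_iff.2 x.norm_snd_le⟩),
      by fun_prop⟩
  -- The second term vanishes on the sides and is at least 1 over the half-size base, where the
  -- height is thus unchanged.
  let r : C(UnitBall (ℝ × F), I) :=
    ⟨fun x => Set.projIcc 0 1 zero_le_one (min ((x.1.1 + 1) / 2) (2 * (1 - ‖x.1.2‖))),
      continuous_projIcc.comp (by fun_prop)⟩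
  have hds : ∀ p, d (s p) = p.1 := by
    intro p
    ext1
    have h := hhalf p.1
    refine (UnitBall.dilate_of_le _ _ ?_).trans ?_
    · simp only [s, UnitBall.pair, ContinuousMap.coe_mk, Set.Icc.coe_one]
      linarith
    · simp only [s, UnitBall.pair, ContinuousMap.coe_mk, Set.Icc.coe_one]
      rw [smul_smul]
      norm_num
  refine ⟨⟨fun x => ⟨s (x, 0), Or.inl ?_⟩, by fun_prop⟩, s, d.comp (subsetIncl _),
    d.prodMk r, fun _ => rfl, ?_, fun x => hds _, fun p => Prod.ext (hds p) ?_⟩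
  · simp [s, UnitBall.pair]
  · rintro ⟨x, hx⟩
    refine Prod.ext rfl (Eq.symm ?_)
    refine Set.projIcc_of_le_left zero_le_one ?_
    rcases hx with hx | hx
    · refine (min_le_left _ _).trans ?_
      simp only [subsetIncl_apply]
      rw [hx]
      norm_num
    · refine (min_le_right _ _).trans ?_
      simp only [subsetIncl_apply]
      rw [hx]
      norm_num
  · have h := hhalf p.1
    have h₁ := p.2.2.2
    ext
    change ((Set.projIcc 0 1 zero_le_one (min ((2 * (p.2 : ℝ) - 1 + 1) / 2)
      (2 * (1 - ‖(2⁻¹ : ℝ) • (p.1 : F)‖))) : I) : ℝ) = p.2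
    rw [min_eq_left (by linarith), sub_add_cancel, mul_div_cancel_left₀ _ two_ne_zero,
      Set.projIcc_val]

end

/-! ### Path fibrations and deformation retracts -/

section MappingPathSpace

variable {A B : Type*} [TopologicalSpace A] [TopologicalSpace B]

/-- The mapping path space of `f`. -/
abbrev MappingPathSpace (f : C(A, B)) : Type _ := {p : A × C(I, B) // p.2 0 = f p.1}

/-- The evaluation of paths at their end point. -/
def MappingPathSpace.endpoint (f : C(A, B)) : C(MappingPathSpace f, B) :=
  ⟨fun p => p.1.2 1, by fun_prop⟩

/-- The constant paths. -/
def MappingPathSpace.const (f : C(A, B)) : C(A, MappingPathSpace f) :=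
  ⟨fun a => ⟨(a, ContinuousMap.const _ (f a)), rfl⟩,
    (continuous_id.prodMk (ContinuousMap.continuous_const'.comp f.continuous)).subtype_mk _⟩

/-- To follow a motion of the end point up to time `t`, the path is prolonged by the motion and
reparametrized at speed `1 + t`. At `t = 0` nothing changes, so the lift extends the given one. -/
theorem strictLift_endpoint (f : C(A, B)) (D : Type*) [TopologicalSpace D] :
    StrictLift (bottomIncl D) (MappingPathSpace.endpoint f) := by
  intro u v huv
  let G : C((D × I) × I, B) :=
    ⟨fun z => if (z.2 : ℝ) * (1 + z.1.2) ≤ 1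
      then (u z.1.1).1.2 (Set.projIcc 0 1 zero_le_one ((z.2 : ℝ) * (1 + z.1.2)))
      else v (z.1.1, Set.projIcc 0 1 zero_le_one ((z.2 : ℝ) * (1 + z.1.2) - 1)), by
      have h₁ : Continuous fun z : (D × I) × I =>
          (Set.projIcc 0 1 zero_le_one ((z.2 : ℝ) * (1 + z.1.2)) : I) :=
        continuous_projIcc.comp (by fun_prop)
      have h₂ : Continuous fun z : (D × I) × I =>
          (Set.projIcc 0 1 zero_le_one ((z.2 : ℝ) * (1 + z.1.2) - 1) : I) :=
        continuous_projIcc.comp (by fun_prop)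
      refine Continuous.if_le (by fun_prop) (by fun_prop) (by fun_prop) (by fun_prop) ?_
      intro z hz
      rw [hz, sub_self, Set.projIcc_left, Set.projIcc_right]
      exact huv z.1.1⟩
  have hG : ∀ z : D × I, G.curry z 0 = f (u z.1).1.1 := fun z => by
    refine Eq.trans ?_ (u z.1).2
    change ite _ _ _ = _
    simp
  let w : C(D × I, MappingPathSpace f) := ⟨fun z => ⟨((u z.1).1.1, G.curry z), hG z⟩,
    ((continuous_fst.comp (continuous_subtype_val.comp (u.continuous.comp
      continuous_fst))).prodMk G.curry.continuous).subtype_mk hG⟩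
  refine ⟨w, fun d => Subtype.ext (Prod.ext rfl (ContinuousMap.ext fun t => ?_)), fun z => ?_⟩
  · change ite _ _ _ = _
    simp only [bottomIncl, ContinuousMap.coe_mk, Set.Icc.coe_zero, add_zero, mul_one]
    rw [if_pos t.2.2, Set.projIcc_val]
  · change ite _ _ _ = _
    simp only [Set.Icc.coe_one, one_mul, add_sub_cancel_left, Set.projIcc_val]
    split_ifs with h
    · have hz : z.2 = 0 := le_antisymm (Subtype.coe_le_coe.1 (by simpa using h)) z.2.2.1
      have := huv z.1
      obtain ⟨d, t⟩ := z
      simp only at hz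
      subst hz
      exact (congrArg (u d).1.2 (by simp)).trans this
    · rfl

/-- A map with the left lifting property with respect to its mapping path fibration is the
inclusion of a strong deformation retract, and it can be used for lifting up to homotopy. -/
theorem StrictLift.homotopyLift_of_endpoint {f : C(A, B)}
    (h : StrictLift f (MappingPathSpace.endpoint f)) {S D : Type*} [TopologicalSpace S]
    [TopologicalSpace D] (j : C(S, D)) : HomotopyLift j f := by
  intro u v huv
  -- The lift assigns to `b` a point `r b` of `A` and a path from `f (r b)` to `b`, constant when
  -- `b` comes from `A`. The map `r ∘ v` solves the problem, and the reversed paths give the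
  -- homotopy.
  obtain ⟨l, hl, hl'⟩ := h (MappingPathSpace.const f) (.id B) fun _ => rfl
  refine ⟨⟨fun d => (l (v d)).1.1, by fun_prop⟩, (ContinuousMap.Homotopy.refl u).cast rfl ?_,
    ⟨⟨fun z => (l (v z.2)).1.2 (unitInterval.symm z.1), by fun_prop⟩, fun d => ?_, fun d => ?_⟩,
    fun t a => ?_⟩
  · ext a
    simp only [ContinuousMap.comp_apply, ContinuousMap.coe_mk]
    rw [← huv, hl]
    rfl
  · simp only [unitInterval.symm_zero]
    exact hl' (v d)
  · simp only [unitInterval.symm_one]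
    exact (l (v d)).2
  · change f (u a) = (l (v (j a))).1.2 _
    rw [← huv, hl]
    rfl

end MappingPathSpace

end SerreFibrations

/-! ### Serre fibrations in the category of topological spaces -/

section LiftingInTopCat

theorem hasLiftingProperty_iff_strictLift {A B X Y : TopCat.{u}} (i : A ⟶ B) (f : X ⟶ Y) :
    HasLiftingProperty i f ↔ StrictLift i.hom f.hom := by
  constructor
  · intro h u v huv
    have sq : CommSq (TopCat.ofHom u) i f (TopCat.ofHom v) := ⟨by ext a; exact huv a⟩
    exact ⟨sq.lift.hom, fun a => ConcreteCategory.congr_hom sq.fac_left a,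
      fun b => ConcreteCategory.congr_hom sq.fac_right b⟩
  · intro h
    refine ⟨fun {u v} sq => ?_⟩
    obtain ⟨w, hw, hw'⟩ := h u.hom v.hom fun a => ConcreteCategory.congr_hom sq.w a
    exact ⟨⟨⟨TopCat.ofHom w, by ext a; exact hw a, by ext b; exact hw' b⟩⟩⟩

theorem MorphismProperty.ofHoms_rlp_iff {C : Type u} [Category.{v} C] {ι : Type*} {A B : ι → C}
    (i : ∀ n, A n ⟶ B n) {X Y : C} (f : X ⟶ Y) :
    (MorphismProperty.ofHoms i).rlp f ↔ ∀ n, HasLiftingProperty (i n) f := by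
  constructor
  · exact fun h n => h _ ⟨n⟩
  · rintro h _ _ _ ⟨n⟩
    exact h n

theorem isArrowRetract_diskBoundaryInclusion (n : ℕ) :
    IsArrowRetract (TopCat.diskBoundaryInclusion.{u} n).hom
      (sphereIncl (EuclideanSpace ℝ (Fin n))) :=
  ⟨⟨fun a => ⟨⟨a.down.1, Metric.sphere_subset_closedBall a.down.2⟩,
      mem_sphere_zero_iff_norm.1 a.down.2⟩,
      ((continuous_subtype_val.comp continuous_uliftDown).subtype_mk _).subtype_mk _⟩,
    ⟨fun b => b.down, continuous_uliftDown⟩,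
    ⟨fun a => ⟨⟨a.1.1, mem_sphere_zero_iff_norm.2 a.2⟩⟩,
      continuous_uliftUp.comp ((continuous_subtype_val.comp continuous_subtype_val).subtype_mk _)⟩,
    ⟨fun b => ⟨b⟩, continuous_uliftUp⟩, fun _ => rfl, fun _ => rfl, fun _ => rfl, fun _ => rfl⟩

theorem isArrowRetract_sphereIncl_diskBoundaryInclusion (n : ℕ) :
    IsArrowRetract (sphereIncl (EuclideanSpace ℝ (Fin n)))
      (TopCat.diskBoundaryInclusion.{u} n).hom :=
  ⟨⟨fun a => ⟨⟨a.1.1, mem_sphere_zero_iff_norm.2 a.2⟩⟩,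
      continuous_uliftUp.comp ((continuous_subtype_val.comp continuous_subtype_val).subtype_mk _)⟩,
    ⟨fun b => ⟨b⟩, continuous_uliftUp⟩,
    ⟨fun a => ⟨⟨a.down.1, Metric.sphere_subset_closedBall a.down.2⟩,
      mem_sphere_zero_iff_norm.1 a.down.2⟩,
      ((continuous_subtype_val.comp continuous_uliftDown).subtype_mk _).subtype_mk _⟩,
    ⟨fun b => b.down, continuous_uliftDown⟩, fun _ => rfl, fun _ => rfl, fun _ => rfl, fun _ => rfl⟩

theorem isArrowRetract_diskProdZeroInclusion (n : ℕ) :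
    IsArrowRetract (diskProdZeroInclusion.{u} n).hom
      (bottomIncl (UnitBall (EuclideanSpace ℝ (Fin n)))) :=
  ⟨⟨fun a => a.1.down, continuous_uliftDown.comp continuous_fst⟩,
    ⟨fun b => (b.1.down, b.2), (continuous_uliftDown.comp continuous_fst).prodMk continuous_snd⟩,
    ⟨fun a => (⟨a⟩, ⟨0, rfl⟩), continuous_uliftUp.prodMk continuous_const⟩,
    ⟨fun b => (⟨b.1⟩, b.2), (continuous_uliftUp.comp continuous_fst).prodMk continuous_snd⟩,
    fun a => Prod.ext rfl a.2.2.symm, fun _ => rfl,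
    fun a => Prod.ext rfl (Subtype.ext a.2.2.symm), fun _ => rfl⟩

theorem isArrowRetract_bottomIncl_diskProdZeroInclusion (n : ℕ) :
    IsArrowRetract (bottomIncl (UnitBall (EuclideanSpace ℝ (Fin n))))
      (diskProdZeroInclusion.{u} n).hom :=
  ⟨⟨fun a => (⟨a⟩, ⟨0, rfl⟩), continuous_uliftUp.prodMk continuous_const⟩,
    ⟨fun b => (⟨b.1⟩, b.2), (continuous_uliftUp.comp continuous_fst).prodMk continuous_snd⟩,
    ⟨fun a => a.1.down, continuous_uliftDown.comp continuous_fst⟩,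
    ⟨fun b => (b.1.down, b.2), (continuous_uliftDown.comp continuous_fst).prodMk continuous_snd⟩,
    fun _ => rfl, fun a => Prod.ext rfl a.2.2.symm, fun _ => rfl, fun _ => rfl⟩

variable {X Y : TopCat.{u}} (f : X ⟶ Y)

theorem boundaryInclusions_rlp_iff :
    boundaryInclusions.rlp f ↔
      ∀ n, StrictLift (sphereIncl (EuclideanSpace ℝ (Fin n))) f.hom := by
  refine (MorphismProperty.ofHoms_rlp_iff _ f).trans (forall_congr' fun n => ?_)
  rw [hasLiftingProperty_iff_strictLift]
  exact ⟨fun h => h.of_retract (isArrowRetract_sphereIncl_diskBoundaryInclusion n),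
    fun h => h.of_retract (isArrowRetract_diskBoundaryInclusion n)⟩

theorem cylinderInclusions_rlp_iff :
    cylinderInclusions.rlp f ↔
      ∀ n, StrictLift (bottomIncl (UnitBall (EuclideanSpace ℝ (Fin n)))) f.hom := by
  refine (MorphismProperty.ofHoms_rlp_iff _ f).trans (forall_congr' fun n => ?_)
  rw [hasLiftingProperty_iff_strictLift]
  exact ⟨fun h => h.of_retract (isArrowRetract_bottomIncl_diskProdZeroInclusion n),
    fun h => h.of_retract (isArrowRetract_diskProdZeroInclusion n)⟩

theorem finrank_prod_euclideanSpace (n : ℕ) :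
    Module.finrank ℝ (ℝ × EuclideanSpace ℝ (Fin n)) =
      Module.finrank ℝ (EuclideanSpace ℝ (Fin (n + 1))) := by
  simp [add_comm]

theorem isArrowRetract_bottomIncl_prod (n : ℕ) :
    IsArrowRetract (bottomIncl (UnitBall (ℝ × EuclideanSpace ℝ (Fin n))))
      (bottomIncl (UnitBall (EuclideanSpace ℝ (Fin (n + 1))))) := by
  obtain ⟨e, -⟩ := exists_unitBall_homeomorph (finrank_prod_euclideanSpace n)
  exact isArrowRetract_bottomIncl e e.symm e.symm_apply_apply

/-- Boxes mediate between spheres and cylinders: the bottom inclusion over the `n`-disc is a retract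
of a box, and that box is a retract of the bottom inclusion over the `(n + 1)`-disc. -/
theorem boundaryInclusions_rlp_eq :
    boundaryInclusions.rlp = cylinderInclusions.rlp ⊓ weakHomotopyEquivalences.{u} := by
  ext X Y f
  change _ ↔ cylinderInclusions.rlp f ∧ IsWeakHomotopyEquivalence f.hom
  rw [boundaryInclusions_rlp_iff, cylinderInclusions_rlp_iff,
    isWeakHomotopyEquivalence_iff_homotopyLift]
  constructor
  · intro h
    refine ⟨fun n => ?_, fun n => (h n).homotopyLift⟩
    refine StrictLift.of_retract (StrictLift.box (h n) ?_) isArrowRetract_bottomIncl_boxIncl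
    exact (h (n + 1)).of_retract (isArrowRetract_sphereIncl (finrank_prod_euclideanSpace n))
  · rintro ⟨h, h'⟩ n
    refine StrictLift.of_homotopyLift ?_ (h' n)
    exact ((h (n + 1)).of_retract (isArrowRetract_bottomIncl_prod n)).of_retract
      isArrowRetract_boxIncl

/-- The endpoint map of `f` is itself a Serre fibration, so `f` lifts against it; no analysis of
cell complexes is needed. -/
theorem cylinderInclusions_rlp_llp_le :
    cylinderInclusions.rlp.llp ≤ weakHomotopyEquivalences.{u} := by
  intro X Y f hf
  refine isWeakHomotopyEquivalence_iff_homotopyLift.2 fun n => ?_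
  refine StrictLift.homotopyLift_of_endpoint (?_ : StrictLift f.hom _) _
  refine (hasLiftingProperty_iff_strictLift f
    (TopCat.ofHom (MappingPathSpace.endpoint f.hom))).1 (hf _ ?_)
  exact (cylinderInclusions_rlp_iff _).2 fun _ => strictLift_endpoint _ _

instance : weakHomotopyEquivalences.{u}.HasTwoOutOfThreeProperty where
  comp_mem _ _ hf hg := IsWeakHomotopyEquivalence.comp hf hg
  of_postcomp _ _ hg hgf := IsWeakHomotopyEquivalence.of_postcomp hg hgf
  of_precomp _ _ hf hgf := IsWeakHomotopyEquivalence.of_precomp hf hgf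

end LiftingInTopCat

end UnitInterval

/-! ### Relatively `T₁` closed embeddings -/

section ClosedEmbeddings

/-- The type of propositions with the indiscrete topology. -/
@[ext]
structure IndiscreteProp : Type u where
  /-- the underlying proposition -/
  down : Prop

instance : TopologicalSpace IndiscreteProp.{u} := ⊤

/-- The product of the Sierpinski space and of an indiscrete space with two points. -/
def embeddingTestSpace : TopCat.{u} := TopCat.of (ULift.{u} Prop × IndiscreteProp.{u})

/-- The map from the test space for embeddings to the point. -/
def embeddingTest : embeddingTestSpace.{u} ⟶ TopCat.of PUnit.{u + 1} :=
  TopCat.ofHom (ContinuousMap.const _ PUnit.unit)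

theorem continuous_indiscreteProp {X : Type*} [TopologicalSpace X] (g : X → IndiscreteProp.{u}) :
    Continuous g :=
  continuous_top

/-- A map to the test space is an open set together with an arbitrary subset. Extending open sets
says that the topology is induced; extending arbitrary subsets says that `i` is injective. -/
theorem isEmbedding_iff_hasLiftingProperty {A B : TopCat.{u}} (i : A ⟶ B) :
    IsEmbedding i ↔ HasLiftingProperty i embeddingTest.{u} := by
  rw [hasLiftingProperty_iff_strictLift]
  constructor
  · intro hi u v _
    have hU : IsOpen {a | (u a).1.down} :=
      continuous_Prop.1 (continuous_uliftDown.comp (continuous_fst.comp u.continuous))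
    obtain ⟨V, hV, hV'⟩ := hi.isOpen_iff.1 hU
    refine ⟨⟨fun b => (⟨b ∈ V⟩, ⟨b ∈ i '' {a | (u a).2.down}⟩),
      (continuous_uliftUp.comp (continuous_Prop.2 hV)).prodMk (continuous_indiscreteProp _)⟩,
      fun a => Prod.ext (ULift.ext _ _ ?_) (IndiscreteProp.ext ?_), fun _ => rfl⟩
    · exact congrArg (a ∈ ·) hV'
    · exact propext (hi.injective.mem_set_image (s := {a | (u a).2.down}))
  · intro h
    refine ⟨⟨le_antisymm i.hom.continuous.le_induced fun U hU => ?_⟩, fun a b hab => ?_⟩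
    · obtain ⟨w, hw, -⟩ := h ⟨fun a => (⟨a ∈ U⟩, ⟨True⟩),
        (continuous_uliftUp.comp (continuous_Prop.2 hU)).prodMk (continuous_indiscreteProp _)⟩
        (ContinuousMap.const _ PUnit.unit) fun _ => rfl
      refine ⟨{b | (w b).1.down}, continuous_Prop.1
        (continuous_uliftDown.comp (continuous_fst.comp w.continuous)), ?_⟩
      ext a
      exact iff_of_eq (congrArg (fun z => z.1.down) (hw a))
    · obtain ⟨w, hw, -⟩ := h ⟨fun x => (⟨True⟩, ⟨x = a⟩),
        continuous_const.prodMk (continuous_indiscreteProp _)⟩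
        (ContinuousMap.const _ PUnit.unit) fun _ => rfl
      have h₁ := congrArg (fun z => z.2.down) (hw a)
      have h₂ := congrArg (fun z => z.2.down) (hw b)
      exact (h₂.symm.trans ((congrArg (fun z => (w z).2.down) hab.symm).trans h₁)).mpr rfl |>.symm

/-- Arbitrary subsets are continuous maps to an indiscrete space, so compatible subsets of the
stages glue by the universal property. -/
theorem exists_set_of_isColimit {J : Type*} [Category J] {F : J ⥤ TopCat.{u}} {c : Cocone F}
    (hc : IsColimit c) (Z : ∀ j, Set (F.obj j))
    (hZ : ∀ ⦃i j : J⦄ (φ : i ⟶ j) (x : F.obj i), F.map φ x ∈ Z j ↔ x ∈ Z i) :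
    ∃ S : Set c.pt, ∀ (j : J) (x : F.obj j), c.ι.app j x ∈ S ↔ x ∈ Z j := by
  let s : Cocone F :=
    { pt := TopCat.of IndiscreteProp.{u}
      ι := { app := fun j => TopCat.ofHom ⟨fun x => ⟨x ∈ Z j⟩, continuous_indiscreteProp _⟩
             naturality := fun i j φ => by
              ext x
              exact congrArg IndiscreteProp.mk (propext (hZ φ x)) } }
  refine ⟨{x | (hc.desc s x).down}, fun j x => ?_⟩
  exact iff_of_eq (congrArg IndiscreteProp.down (ConcreteCategory.congr_hom (hc.fac s j) x))

theorem exists_rep_of_isColimit {J : Type*} [Category J] {F : J ⥤ TopCat.{u}} {c : Cocone F}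
    (hc : IsColimit c) (y : c.pt) : ∃ (j : J) (x : F.obj j), c.ι.app j x = y := by
  by_contra! h
  let s : Cocone F :=
    { pt := TopCat.of IndiscreteProp.{u}
      ι := { app := fun j => TopCat.ofHom ⟨fun x => ⟨True⟩, continuous_indiscreteProp _⟩ } }
  -- If `y` came from no stage, the whole space and the complement of `y` would restrict identically
  -- to every stage.
  have h₁ := hc.uniq s (TopCat.ofHom ⟨fun _ => ⟨True⟩, continuous_indiscreteProp _⟩) fun j => rfl
  have h₂ := hc.uniq s (TopCat.ofHom ⟨fun z => ⟨z ≠ y⟩, continuous_indiscreteProp _⟩) fun j => by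
    ext x
    exact iff_of_true (h j x) True.intro
  have h₃ := congrArg IndiscreteProp.down (ConcreteCategory.congr_hom (h₂.trans h₁.symm) y)
  exact (h₃.mpr True.intro : y ≠ y) rfl

/-! ### Subsets and points of pushouts -/

section Pushouts

variable {A A' B B' : TopCat.{u}} {f : A ⟶ A'} {g : A ⟶ B} {f' : B ⟶ B'} {g' : A' ⟶ B'}
  (sq : IsPushout g f f' g')

include sq

theorem exists_set_of_isPushout (Z : Set B) (Z' : Set A') (h : ∀ a : A, g a ∈ Z ↔ f a ∈ Z') :
    ∃ S : Set B', (∀ b : B, f' b ∈ S ↔ b ∈ Z) ∧ ∀ a : A', g' a ∈ S ↔ a ∈ Z' := by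
  let χ {X : TopCat.{u}} (Z : Set X) : X ⟶ TopCat.of IndiscreteProp.{u} :=
    TopCat.ofHom ⟨fun x => ⟨x ∈ Z⟩, continuous_indiscreteProp _⟩
  have w : g ≫ χ Z = f ≫ χ Z' := by
    ext a
    exact h a
  refine ⟨{x | (sq.desc (χ Z) (χ Z') w x).down}, fun b => ?_, fun a => ?_⟩
  · exact iff_of_eq (congrArg IndiscreteProp.down
      (ConcreteCategory.congr_hom (sq.inl_desc (χ Z) (χ Z') w) b))
  · exact iff_of_eq (congrArg IndiscreteProp.down
      (ConcreteCategory.congr_hom (sq.inr_desc (χ Z) (χ Z') w) a))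

theorem exists_rep_of_isPushout (y : B') : (∃ b : B, f' b = y) ∨ ∃ a : A', g' a = y := by
  obtain ⟨j, x, rfl⟩ := exists_rep_of_isColimit sq.isColimit y
  rcases j with _ | _ | _
  · exact Or.inl ⟨g x, ConcreteCategory.congr_hom (sq.cocone.w WalkingSpan.Hom.fst) x⟩
  · exact Or.inl ⟨x, rfl⟩
  · exact Or.inr ⟨x, rfl⟩

theorem isClosed_iff_of_isPushout (S : Set B') :
    IsClosed S ↔ IsClosed (f' ⁻¹' S) ∧ IsClosed (g' ⁻¹' S) := by
  refine ⟨fun h => ⟨h.preimage f'.hom.continuous, h.preimage g'.hom.continuous⟩, fun h => ?_⟩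
  refine (TopCat.isClosed_iff_of_isColimit _ sq.isColimit S).2 fun j => ?_
  rcases j with _ | _ | _
  · have h₀ (x : A) : f' (g x) = sq.cocone.ι.app WalkingSpan.zero x :=
      ConcreteCategory.congr_hom (sq.cocone.w WalkingSpan.Hom.fst) x
    refine (Set.ext fun x => ?_ : _ = g ⁻¹' (f' ⁻¹' S)) ▸ h.1.preimage g.hom.continuous
    exact iff_of_eq (congrArg (· ∈ S) (h₀ x).symm)
  · exact h.1
  · exact h.2

end Pushouts

/-- The class of embeddings. -/
def topEmbeddings : MorphismProperty TopCat.{u} := fun _ _ f => IsEmbedding f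

/-- Being a left lifting class, embeddings inherit stability under cobase change, coproducts and
transfinite composition. -/
theorem topEmbeddings_eq_llp :
    topEmbeddings.{u} = (MorphismProperty.ofHoms fun _ : Unit => embeddingTest.{u}).llp := by
  ext A B i
  rw [MorphismProperty.llp_ofHoms_iff_hasLiftingProperty]
  exact isEmbedding_iff_hasLiftingProperty i

instance : topEmbeddings.{u}.IsStableUnderCobaseChange := by
  rw [topEmbeddings_eq_llp]
  infer_instance

instance : MorphismProperty.IsStableUnderCoproducts.{u} topEmbeddings.{u} := by
  rw [topEmbeddings_eq_llp]
  infer_instance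

instance : MorphismProperty.IsStableUnderTransfiniteComposition.{u} topEmbeddings.{u} := by
  rw [topEmbeddings_eq_llp]
  infer_instance

/-- The closed embeddings such that the points of the complement of the image are closed. -/
def closedT1Embeddings : MorphismProperty TopCat.{u} := fun _ Y f =>
  IsClosedEmbedding f ∧ ∀ y : Y, y ∉ Set.range f → IsClosed {y}

theorem closedT1Embeddings_le_topEmbeddings : closedT1Embeddings.{u} ≤ topEmbeddings :=
  fun _ _ _ h => h.1.isEmbedding

instance : closedT1Embeddings.{u}.IsMultiplicative where
  id_mem X := ⟨Topology.IsClosedEmbedding.id, fun y hy => absurd ⟨y, rfl⟩ hy⟩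
  comp_mem {X Y Z} f g hf hg := by
    refine ⟨hg.1.comp hf.1, fun z hz => ?_⟩
    by_cases h : z ∈ Set.range g
    · obtain ⟨y, rfl⟩ := h
      have := hg.1.isClosedMap _ (hf.2 y fun ⟨x, hx⟩ => hz ⟨x, congrArg g hx⟩)
      rwa [Set.image_singleton] at this
    · exact hg.2 z h

theorem closedT1Embeddings_of_isIso {X Y : TopCat.{u}} (f : X ⟶ Y) [IsIso f] :
    closedT1Embeddings f := by
  let h := TopCat.homeoOfIso (asIso f)
  exact ⟨h.isClosedEmbedding, fun y hy => absurd (h.surjective y) hy⟩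

instance : closedT1Embeddings.{u}.IsStableUnderCobaseChange where
  of_isPushout {A A' B B' f g f' g'} sq hf := by
    have hf' : IsEmbedding f' :=
      MorphismProperty.of_isPushout (P := topEmbeddings) sq hf.1.isEmbedding
    refine ⟨⟨hf', ?_⟩, fun y hy => ?_⟩
    · obtain ⟨S, hS, hS'⟩ := exists_set_of_isPushout sq Set.univ (Set.range f) fun a =>
        iff_of_true trivial ⟨a, rfl⟩
      have : Set.range f' = S := by
        refine Set.Subset.antisymm (Set.range_subset_iff.2 fun b => (hS b).2 trivial) fun y hy => ?_
        rcases exists_rep_of_isPushout sq y with ⟨b, rfl⟩ | ⟨a, rfl⟩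
        · exact ⟨b, rfl⟩
        · obtain ⟨x, rfl⟩ := (hS' a).1 hy
          exact ⟨g x, ConcreteCategory.congr_hom sq.w x⟩
      rw [this, isClosed_iff_of_isPushout sq]
      constructor
      · exact (Set.ext hS : f' ⁻¹' S = _) ▸ isClosed_univ
      · exact (Set.ext hS' : g' ⁻¹' S = _) ▸ hf.1.isClosed_range
    · obtain ⟨b, rfl⟩ | ⟨a, rfl⟩ := exists_rep_of_isPushout sq y
      · exact absurd ⟨b, rfl⟩ hy
      have ha : a ∉ Set.range f := by
        rintro ⟨x, rfl⟩
        exact hy ⟨g x, ConcreteCategory.congr_hom sq.w x⟩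
      obtain ⟨S, hS, hS'⟩ := exists_set_of_isPushout sq ∅ {a} fun x =>
        iff_of_false id fun h => ha ⟨x, h⟩
      have : {g' a} = S := by
        refine Set.Subset.antisymm (Set.singleton_subset_iff.2 ((hS' a).2 rfl)) fun y hy => ?_
        rcases exists_rep_of_isPushout sq y with ⟨b, rfl⟩ | ⟨x, rfl⟩
        · exact ((hS b).1 hy).elim
        · exact congrArg g' ((hS' x).1 hy)
      rw [this, isClosed_iff_of_isPushout sq]
      constructor
      · exact (Set.ext hS : f' ⁻¹' S = _) ▸ isClosed_empty
      · exact (Set.ext hS' : g' ⁻¹' S = _) ▸ hf.2 a ha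

instance (J : Type u) : closedT1Embeddings.{u}.IsStableUnderCoproductsOfShape J where
  condition X₁ X₂ c₁ c₂ h₁ h₂ f hf φ hφ := by
    have hφ' : IsEmbedding φ :=
      MorphismProperty.IsStableUnderColimitsOfShape.condition (W := topEmbeddings) X₁ X₂ c₁ c₂
        h₁ h₂ f (fun j => (hf j).1.isEmbedding) φ hφ
    refine ⟨⟨hφ', ?_⟩, fun y hy => ?_⟩
    · obtain ⟨S, hS⟩ := exists_set_of_isColimit h₂ (fun j => Set.range (f.app j)) (by
        rintro i j φ x
        obtain rfl := Discrete.ext (Discrete.eq_of_hom φ)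
        obtain rfl : φ = 𝟙 _ := Subsingleton.elim _ _
        rw [X₂.map_id]
        rfl)
      have : Set.range φ = S := by
        refine Set.Subset.antisymm (Set.range_subset_iff.2 fun b => ?_) fun y hy => ?_
        · obtain ⟨j, x, rfl⟩ := exists_rep_of_isColimit h₁ b
          have := ConcreteCategory.congr_hom (hφ j) x
          refine (congrArg (· ∈ S) this).mpr ((hS j _).2 ⟨x, rfl⟩)
        · obtain ⟨j, x, rfl⟩ := exists_rep_of_isColimit h₂ y
          obtain ⟨z, rfl⟩ := (hS j x).1 hy
          exact ⟨c₁.ι.app j z, ConcreteCategory.congr_hom (hφ j) z⟩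
      rw [this, TopCat.isClosed_iff_of_isColimit _ h₂]
      intro j
      exact (Set.ext (hS j) : c₂.ι.app j ⁻¹' S = _) ▸ (hf j).1.isClosed_range
    · obtain ⟨j, x, rfl⟩ := exists_rep_of_isColimit h₂ y
      have hx : x ∉ Set.range (f.app j) := by
        rintro ⟨z, rfl⟩
        exact hy ⟨c₁.ι.app j z, ConcreteCategory.congr_hom (hφ j) z⟩
      obtain ⟨S, hS⟩ := exists_set_of_isColimit h₂
        -- Equality in the sigma type describes `{x}` in summand `j` and the empty set in the
        -- others, without casts.
        (fun i => {z | (⟨i, z⟩ : Σ i, X₂.obj i) = ⟨j, x⟩}) (by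
        rintro i j φ x
        obtain rfl := Discrete.ext (Discrete.eq_of_hom φ)
        obtain rfl : φ = 𝟙 _ := Subsingleton.elim _ _
        rw [X₂.map_id]
        rfl)
      have : {c₂.ι.app j x} = S := by
        refine Set.Subset.antisymm (Set.singleton_subset_iff.2 ((hS j x).2 rfl)) fun y hy => ?_
        obtain ⟨i, z, rfl⟩ := exists_rep_of_isColimit h₂ y
        obtain ⟨rfl, h⟩ := Sigma.mk.inj_iff.1 ((hS i z).1 hy)
        exact congrArg (c₂.ι.app i) (eq_of_heq h)
      rw [this, TopCat.isClosed_iff_of_isColimit _ h₂]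
      intro i
      refine (Set.ext (hS i) : c₂.ι.app i ⁻¹' S = _) ▸ ?_
      by_cases hij : i = j
      · subst hij
        convert! (hf i).2 x hx using 1
        ext z
        simp
      · convert! isClosed_empty using 1
        ext z
        exact iff_of_false (fun h => hij (congrArg Sigma.fst h)) id

instance : MorphismProperty.IsStableUnderCoproducts.{u} closedT1Embeddings.{u} where

end ClosedEmbeddings

/-! ### Finiteness of compact spaces -/

section Finiteness

theorem IsClosed.of_forall_mem_iff {X : Type*} [TopologicalSpace X] {S T : Set X} (hS : IsClosed S)
    (h : ∀ x, x ∈ S ↔ x ∈ T) : IsClosed T :=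
  Set.ext h ▸ hS

/-- A colimit of a chain of relatively `T₁` closed embeddings. -/
theorem closedT1Embeddings_of_isColimit {J : Type*} [LinearOrder J] [OrderBot J] {F : J ⥤ TopCat.{u}}
    {c : Cocone F} (hc : IsColimit c)
    (h : ∀ j : J, closedT1Embeddings (F.map (homOfLE (bot_le : ⊥ ≤ j))))
    (h' : ∀ j : J, topEmbeddings (c.ι.app j)) : closedT1Embeddings (c.ι.app ⊥) := by
  have hw (j : J) (x : F.obj ⊥) : c.ι.app j (F.map (homOfLE bot_le) x) = c.ι.app ⊥ x :=
    ConcreteCategory.congr_hom (c.w (homOfLE (bot_le : ⊥ ≤ j))) x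
  refine ⟨⟨h' ⊥, ?_⟩, fun y hy => ?_⟩
  · rw [TopCat.isClosed_iff_of_isColimit _ hc]
    intro j
    refine (Set.ext fun x => ?_ : _ = c.ι.app j ⁻¹' Set.range (c.ι.app ⊥)) ▸ (h j).1.isClosed_range
    constructor
    · rintro ⟨z, rfl⟩
      exact ⟨z, (hw j z).symm⟩
    · rintro ⟨z, hz⟩
      exact ⟨z, (h' j).injective ((hw j z).trans hz)⟩
  · rw [TopCat.isClosed_iff_of_isColimit _ hc]
    intro j
    by_cases hj : ∃ x : F.obj j, c.ι.app j x = y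
    · obtain ⟨x, rfl⟩ := hj
      refine (Set.ext fun z => ?_ : {x} = c.ι.app j ⁻¹' {c.ι.app j x}) ▸ (h j).2 x ?_
      · exact (h' j).injective.eq_iff.symm
      · rintro ⟨z, rfl⟩
        exact hy ⟨z, (hw j z).symm⟩
    · exact (Set.ext fun z => iff_of_false id fun hz => hj ⟨z, hz⟩ :
        ∅ = c.ι.app j ⁻¹' {y}) ▸ isClosed_empty

instance (J : Type u) [LinearOrder J] [SuccOrder J] [OrderBot J] [WellFoundedLT J] :
    closedT1Embeddings.{u}.IsStableUnderTransfiniteCompositionOfShape J where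
  le := by
    rintro X Y f ⟨hf⟩
    let hf' := hf.ofLE closedT1Embeddings_le_topEmbeddings
    -- That all maps of the chain are embeddings is already known from the lifting characterization;
    -- the induction adds closedness and the condition on points.
    have key (j : J) : closedT1Embeddings (hf.F.map (homOfLE (bot_le : ⊥ ≤ j))) := by
      induction j using SuccOrder.limitRecOn with
      | isMin j hj =>
        obtain rfl := hj.eq_bot
        exact (hf.F.map_id _).symm ▸ closedT1Embeddings.id_mem _
      | succ j hj hj' =>
        rw [← homOfLE_comp bot_le (Order.le_succ j), hf.F.map_comp]
        exact closedT1Embeddings.comp_mem _ _ hj' (hf.map_mem j hj)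
      | isSuccLimit j hj hj' =>
        let : OrderBot (Set.Iio j) :=
          { bot := ⟨⊥, Order.IsSuccLimit.bot_lt hj⟩
            bot_le _ := bot_le }
        exact closedT1Embeddings_of_isColimit (hf.F.isColimitOfIsWellOrderContinuous j hj)
          (fun k => hj' k.1 k.2) fun k => hf'.mem_map (homOfLE k.2.le)
    rw [← hf.fac]
    exact closedT1Embeddings.comp_mem _ _ (closedT1Embeddings_of_isIso _)
      (closedT1Embeddings_of_isColimit hf.isColimit key hf'.mem_incl_app)

instance : MorphismProperty.IsStableUnderTransfiniteComposition.{u} closedT1Embeddings.{u} where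

variable {J : Type u} [LinearOrder J] [SuccOrder J] [OrderBot J] [WellFoundedLT J]
  {X Y : TopCat.{u}} {f : X ⟶ Y} (hf : closedT1Embeddings.TransfiniteCompositionOfShape J f)

include hf

/-- The union of the stages of a transfinite composition is everything. -/
theorem exists_mem_range_incl (y : Y) : ∃ j, y ∈ Set.range (hf.incl.app j) := by
  obtain ⟨j, x, rfl⟩ := exists_rep_of_isColimit hf.isColimit y
  exact ⟨j, x, rfl⟩

theorem range_incl_mono {i j : J} (hij : i ≤ j) :
    Set.range (hf.incl.app i) ⊆ Set.range (hf.incl.app j) := by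
  rintro _ ⟨x, rfl⟩
  exact ⟨hf.F.map (homOfLE hij) x, ConcreteCategory.congr_hom (hf.incl.naturality (homOfLE hij)) x⟩

/-- A subset with at most one point in each layer of a transfinite composition is closed. -/
theorem isClosed_of_subsingleton_layers {S : Set Y} (h₀ : ∀ y ∈ S, y ∉ Set.range (hf.incl.app ⊥))
    (h : ∀ j, ∀ y ∈ S, ∀ z ∈ S, y ∈ Set.range (hf.incl.app (Order.succ j)) →
      z ∈ Set.range (hf.incl.app (Order.succ j)) → y ∉ Set.range (hf.incl.app j) →
      z ∉ Set.range (hf.incl.app j) → y = z) : IsClosed S := by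
  rw [TopCat.isClosed_iff_of_isColimit _ hf.isColimit]
  intro j
  change IsClosed (hf.incl.app j ⁻¹' S)
  induction j using SuccOrder.limitRecOn with
  | isMin j hj =>
    obtain rfl := hj.eq_bot
    exact (Set.ext fun x => iff_of_false id fun hx => h₀ _ hx ⟨x, rfl⟩ :
      ∅ = hf.incl.app ⊥ ⁻¹' S) ▸ isClosed_empty
  | succ j hj hj' =>
    have hj := hf.mem_incl_app j
    have h₁ : IsClosed (S ∩ Set.range (hf.incl.app j)) := by
      rw [← Set.image_preimage_eq_inter_range]
      exact hj.1.isClosedMap _ hj'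
    have h₂ : IsClosed (S ∩ (Set.range (hf.incl.app (Order.succ j)) \
        Set.range (hf.incl.app j))) := by
      rcases Set.eq_empty_or_nonempty (S ∩ (Set.range (hf.incl.app (Order.succ j)) \
        Set.range (hf.incl.app j))) with he | ⟨y, hy⟩
      · exact he ▸ isClosed_empty
      · refine (hj.2 y hy.2.2).of_forall_mem_iff fun z => ?_
        constructor
        · rintro rfl
          exact hy
        · exact fun hz => h j _ hz.1 _ hy.1 hz.2.1 hy.2.1 hz.2.2 hy.2.2
    refine (Set.ext fun x => Iff.symm ?_ : _ = hf.incl.app (Order.succ j) ⁻¹' S) ▸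
      (h₁.union h₂).preimage (hf.incl.app (Order.succ j)).hom.continuous
    constructor
    · intro hx
      by_cases hx' : hf.incl.app (Order.succ j) x ∈ Set.range (hf.incl.app j)
      · exact Or.inl ⟨hx, hx'⟩
      · exact Or.inr ⟨hx, ⟨x, rfl⟩, hx'⟩
    · rintro (hx | hx)
      · exact hx.1
      · exact hx.1
  | isSuccLimit j hj hj' =>
    refine (TopCat.isClosed_iff_of_isColimit _
      (hf.F.isColimitOfIsWellOrderContinuous j hj) _).2 ?_
    rintro ⟨k, hk⟩
    refine (hj' k hk).of_forall_mem_iff fun x => ?_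
    exact iff_of_eq (congrArg (· ∈ S)
      (ConcreteCategory.congr_hom (hf.incl.naturality (homOfLE hk.le)) x).symm)

/-- Otherwise the image contains a sequence of points entering at ever later stages. A layer
contains at most one of them, so every tail of the sequence is closed; the tails are nonempty and
decreasing with empty intersection, against compactness. -/
theorem exists_range_subset_range_incl {A : Type*} [TopologicalSpace A] [CompactSpace A]
    (g : C(A, Y)) : ∃ j, Set.range g ⊆ Set.range (hf.incl.app j) := by
  by_contra! hg
  have hg' (j : J) : ∃ (a : A) (k : J), g a ∉ Set.range (hf.incl.app j) ∧
      g a ∈ Set.range (hf.incl.app k) := by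
    obtain ⟨_, ⟨a, rfl⟩, ha⟩ := Set.not_subset.1 (hg j)
    obtain ⟨k, hk⟩ := exists_mem_range_incl hf (g a)
    exact ⟨a, k, ha, hk⟩
  choose a k ha hk using hg'
  -- The point chosen for `s n` is missing from stage `s n` but present at stage `s (n + 1)`.
  let s : ℕ → J := fun n => Nat.rec ⊥ (fun _ j => k j) n
  have hs : StrictMono s := strictMono_nat_of_lt_succ fun n =>
    lt_of_not_ge fun h => ha (s n) (range_incl_mono hf h (hk (s n)))
  have hmem {m n : ℕ} (hmn : m < n) : g (a (s m)) ∈ Set.range (hf.incl.app (s n)) :=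
    range_incl_mono hf (hs.monotone (Nat.succ_le_of_lt hmn)) (hk (s m))
  have hlayer (j : J) {m n : ℕ} (hmn : m < n)
      (hm : g (a (s m)) ∉ Set.range (hf.incl.app j))
      (hn : g (a (s n)) ∈ Set.range (hf.incl.app (Order.succ j))) : False := by
    have hj : s n < Order.succ j :=
      lt_of_not_ge fun h => ha (s n) (range_incl_mono hf h hn)
    exact hm (range_incl_mono hf (Order.le_of_lt_succ hj) (hmem hmn))
  have hclosed (n : ℕ) : IsClosed {y | ∃ m, n ≤ m ∧ g (a (s m)) = y} := by
    refine isClosed_of_subsingleton_layers hf ?_ ?_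
    · rintro _ ⟨m, -, rfl⟩ h
      exact ha (s m) (range_incl_mono hf bot_le h)
    · rintro j _ ⟨m, -, rfl⟩ _ ⟨l, -, rfl⟩ hm hl hm' hl'
      rcases lt_trichotomy m l with h | rfl | h
      · exact (hlayer j h hm' hl).elim
      · rfl
      · exact (hlayer j h hl' hm).elim
  obtain ⟨x, hx⟩ := IsCompact.nonempty_iInter_of_sequence_nonempty_isCompact_isClosed
    (fun n => g ⁻¹' {y | ∃ m, n ≤ m ∧ g (a (s m)) = y})
    (fun n x ⟨m, hm, hx⟩ => ⟨m, (Nat.le_succ n).trans hm, hx⟩)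
    (fun n => ⟨a (s n), n, le_rfl, rfl⟩)
    ((hclosed 0).preimage g.continuous).isCompact
    (fun n => (hclosed n).preimage g.continuous)
  rw [Set.mem_iInter] at hx
  obtain ⟨m, -, hm⟩ := hx 0
  obtain ⟨n, hn, hn'⟩ := hx (m + 1)
  exact ha (s n) ((hn'.trans hm.symm) ▸ hmem hn)

end Finiteness

/-- A map from `A` factors through a stage as a map of sets by compactness, and continuously because
that stage is embedded in the colimit. Injectivity of the stage gives uniqueness. -/
theorem isCardinalSmallRelativeTo_closedT1Embeddings (κ : Cardinal.{u}) (A : TopCat.{u})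
    [CompactSpace A] : IsCardinalSmallRelativeTo κ closedT1Embeddings A := by
  intro J _ _ _ _ _ _ F _ hF
  let hf : closedT1Embeddings.TransfiniteCompositionOfShape J (colimit.ι F ⊥) :=
    { F := F
      isoBot := Iso.refl _
      incl := (colimit.cocone F).ι
      isColimit := colimit.isColimit F
      fac := Category.id_comp _
      map_mem := fun j _ => hF j }
  refine preservesColimit_of_preserves_colimit_cocone (colimit.isColimit F)
    (Types.FilteredColimit.isColimitOf' _ _ (fun g => ?_) fun j x y hxy => ⟨j, 𝟙 j, ?_⟩)
  · obtain ⟨j, hj⟩ := exists_range_subset_range_incl hf (TopCat.Hom.hom (X := A) g)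
    have he := (hf.mem_incl_app j).1.isEmbedding
    choose l hl using fun a => hj ⟨a, rfl⟩
    refine ⟨j, TopCat.ofHom ⟨l, he.continuous_iff.2 ?_⟩, ?_⟩
    · exact (funext hl : _ ∘ l = _) ▸ g.hom.continuous
    · exact TopCat.hom_ext (ContinuousMap.ext fun a => (hl a).symm)
  · have he := (hf.mem_incl_app j).1.isEmbedding
    refine congrArg _ (TopCat.hom_ext (ContinuousMap.ext fun a => he.injective ?_))
    exact ConcreteCategory.congr_hom (C := TopCat) hxy a

/-! ### Recognition of finitely generated model structures -/

section Recognition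

variable {C : Type u} [Category.{v} C]

theorem IsCardinalSmallRelativeTo.anti {κ : Cardinal.{v}} {T T' : MorphismProperty C} {A : C}
    (h : IsCardinalSmallRelativeTo κ T A) (hT : T' ≤ T) : IsCardinalSmallRelativeTo κ T' A :=
  fun J _ _ _ _ _ hJ F _ hF => h J hJ F fun j => hT _ (hF j)

section

variable {T : MorphismProperty C} [T.IsStableUnderCobaseChange]

theorem relativeCells_le [MorphismProperty.IsStableUnderTransfiniteComposition.{v} T]
    {I : MorphismProperty C} (hI : I ≤ T) : relativeCells I ≤ T :=
  (MorphismProperty.transfiniteCompositions_le_iff).2 <|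
    (MorphismProperty.pushouts_monotone hI).trans
      (T.isStableUnderCobaseChange_iff_pushouts_le.1 inferInstance)

variable [MorphismProperty.IsStableUnderCoproducts.{v} T]

attribute [local instance] Cardinal.fact_isRegular_aleph0 Cardinal.orderBotAleph0OrdToType

/-- For `κ = 0` the filteredness condition concerns only the empty subset, so smallness holds along
every limit ordinal; sequences indexed by `ω` suffice here. -/
theorem hasSmallObjectArgument_of_isCardinalSmallRelativeTo [HasColimits C]
    (I : MorphismProperty C) [MorphismProperty.IsSmall.{v} I] (hI : I ≤ T)
    (h : ∀ ⦃A B : C⦄ (i : A ⟶ B), I i → IsCardinalSmallRelativeTo 0 T A) :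
    MorphismProperty.HasSmallObjectArgument.{v} I := by
  have hT : (MorphismProperty.coproducts.{v} I).pushouts ≤ T :=
    (MorphismProperty.pushouts_monotone
      ((MorphismProperty.coproducts_monotone hI).trans T.coproducts_le)).trans
      (T.isStableUnderCobaseChange_iff_pushouts_le.1 inferInstance)
  refine ⟨Cardinal.aleph0, inferInstance, inferInstance, { preservesColimit := ?_ }⟩
  intro A B X Y i hi f hf
  have : NoMaxOrder Cardinal.aleph0.{v}.ord.ToType := Cardinal.noMaxOrder le_rfl
  refine h i hi _ (fun S hS => ?_) hf.F fun j => hT _ ?_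
  · have := Cardinal.mk_eq_zero_iff.1 (le_antisymm hS zero_le)
    rw [Set.isEmpty_coe_sort.1 this]
    exact bddAbove_empty
  · exact MorphismProperty.pushouts_monotone (MorphismProperty.coproducts_monotone
      I.ofHoms_homFamily.le) _ (hf.attachCells j (not_isMax j)).pushouts_coproducts

end

/-- The retract argument: when `f` in `L ⊓ W` is factored, two-out-of-three puts the second factor
in `R ⊓ W`, so `f` lifts against it and is a retract of the first factor. -/
theorem inf_eq_llp_of_hasFactorization {W L R L' : MorphismProperty C}
    [W.HasTwoOutOfThreeProperty] (h : MorphismProperty.HasFactorization R.llp R)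
    (hW : R.llp ≤ W) (hLR : L = L'.llp) (hL' : L' = R ⊓ W) : L ⊓ W = R.llp := by
  subst hLR hL'
  refine le_antisymm ?_ (le_inf (MorphismProperty.antitone_llp inf_le_left) hW)
  rintro X Y f ⟨hf, hf'⟩
  have fac := h.nonempty_mapFactorizationData f |>.some
  have hp : W fac.p := W.of_precomp _ _ (hW _ fac.hi) (fac.fac.symm ▸ hf')
  have : HasLiftingProperty f fac.p := hf _ ⟨fac.hp, hp⟩
  exact MorphismProperty.of_retract (RetractArrow.ofLeftLiftingProperty fac.fac) fac.hi

/-- The class `T` is a manageable upper bound for relative cell complexes: it is stable under the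
operations that build them, and smallness is checked against it. -/
theorem exists_isFinitelyGeneratedBy [HasLimits C] [HasColimits C] (W I J T : MorphismProperty C)
    [W.HasTwoOutOfThreeProperty] [MorphismProperty.IsSmall.{v} I] [MorphismProperty.IsSmall.{v} J]
    [T.IsStableUnderCobaseChange] [MorphismProperty.IsStableUnderTransfiniteComposition.{v} T]
    [MorphismProperty.IsStableUnderCoproducts.{v} T] (hI : I ≤ T) (hJ : J ≤ T)
    (hI' : ∀ ⦃A B : C⦄ (i : A ⟶ B), I i →
      IsCardinalSmallRelativeTo 0 T A ∧ IsCardinalSmallRelativeTo 0 T B)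
    (hJ' : ∀ ⦃A B : C⦄ (i : A ⟶ B), J i →
      IsCardinalSmallRelativeTo 0 T A ∧ IsCardinalSmallRelativeTo 0 T B)
    (h₁ : I.rlp = J.rlp ⊓ W) (h₂ : J.rlp.llp ≤ W) :
    ∃ M : ModelCategory C, IsFinitelyGeneratedBy M I J ∧ HasWeakEquivalences M W := by
  have : MorphismProperty.HasSmallObjectArgument.{v} I :=
    hasSmallObjectArgument_of_isCardinalSmallRelativeTo I hI fun _ _ i hi => (hI' i hi).1
  have : MorphismProperty.HasSmallObjectArgument.{v} J :=
    hasSmallObjectArgument_of_isCardinalSmallRelativeTo J hJ fun _ _ j hj => (hJ' j hj).1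
  have h₃ : I.rlp.llp ⊓ W = J.rlp.llp :=
    inf_eq_llp_of_hasFactorization inferInstance h₂ rfl h₁
  let : CategoryWithFibrations C := ⟨J.rlp⟩
  let : CategoryWithCofibrations C := ⟨I.rlp.llp⟩
  let : CategoryWithWeakEquivalences C := ⟨W⟩
  have e₁ : trivialFibrations C = I.rlp := h₁.symm
  have e₂ : trivialCofibrations C = J.rlp.llp := h₃
  have e₃ : cofibrations C = I.rlp.llp := rfl
  have e₄ : fibrations C = J.rlp := rfl
  have : (weakEquivalences C).HasTwoOutOfThreeProperty := ‹W.HasTwoOutOfThreeProperty›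
  have f₁ : MorphismProperty.HasFunctorialFactorization (cofibrations C) (trivialFibrations C) := by
    rw [e₁, e₃]
    infer_instance
  have f₂ : MorphismProperty.HasFunctorialFactorization (trivialCofibrations C) (fibrations C) := by
    rw [e₂, e₄]
    infer_instance
  have : MorphismProperty.IsWeakFactorizationSystem (cofibrations C) (trivialFibrations C) := by
    rw [e₁, e₃]
    exact .mk' _ _ fun i p hi hp => hi p hp
  have : MorphismProperty.IsWeakFactorizationSystem (trivialCofibrations C) (fibrations C) := by
    rw [e₂, e₄]
    exact .mk' _ _ fun i p hi hp => hi p hp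
  have hcells : relativeCells I ≤ T := relativeCells_le hI
  have hfin {A : C} (hA : IsCardinalSmallRelativeTo 0 T A) : IsFiniteRelativeTo (relativeCells I) A :=
    ⟨0, Cardinal.aleph0_pos, hA.anti hcells⟩
  exact ⟨ModelCategory.mk' C,
    { hasLimits := inferInstance
      hasColimits := inferInstance
      factorization_cofibrations := f₁
      factorization_trivialCofibrations := f₂
      isSmall_I := inferInstance
      isSmall_J := inferInstance
      small_domain_I := fun A B i hi => ⟨0, (hI' i hi).1.anti hcells⟩
      small_domain_J := fun A B j hj => ⟨0, (hJ' j hj).1.anti (relativeCells_le hJ)⟩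
      fibrations_eq := rfl
      trivialFibrations_eq := e₁
      finite_I := fun A B i hi => ⟨hfin (hI' i hi).1, hfin (hI' i hi).2⟩
      finite_J := fun A B j hj => ⟨hfin (hJ' j hj).1, hfin (hJ' j hj).2⟩ }, rfl⟩

theorem IsCofibrantlyGeneratedBy.cofibrations_eq {M : ModelCategory C} {I J : MorphismProperty C}
    (h : IsCofibrantlyGeneratedBy M I J) : cofibrations C = I.rlp.llp := by
  rw [← h.trivialFibrations_eq]
  exact (MorphismProperty.llp_eq_of_wfs _ _).symm

theorem IsCofibrantlyGeneratedBy.trivialCofibrations_eq {M : ModelCategory C}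
    {I J : MorphismProperty C} (h : IsCofibrantlyGeneratedBy M I J) :
    trivialCofibrations C = J.rlp.llp := by
  rw [← h.fibrations_eq]
  exact (MorphismProperty.llp_eq_of_wfs _ _).symm

end Recognition

/-! ### Transport along a coreflective inclusion -/

section Transport

variable {C : Type u} [Category.{v} C] {D : Type u'} [Category.{v'} D]

instance (T : MorphismProperty D) [T.IsStableUnderCobaseChange] (F : C ⥤ D)
    [PreservesColimitsOfShape WalkingSpan F] : (T.inverseImage F).IsStableUnderCobaseChange where
  of_isPushout sq hf := MorphismProperty.of_isPushout (P := T) (sq.map F) hf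

instance (T : MorphismProperty D) [MorphismProperty.IsStableUnderCoproducts.{v} T] (F : C ⥤ D)
    [PreservesColimitsOfSize.{v, v} F] :
    MorphismProperty.IsStableUnderCoproducts.{v} (T.inverseImage F) where
  isStableUnderCoproductsOfShape J :=
    { condition := fun X₁ X₂ c₁ c₂ h₁ h₂ f hf φ hφ => by
        have := preservesColimitsOfShape_of_equiv (Discrete.equivalence (Equiv.refl J)) F
        refine MorphismProperty.IsStableUnderColimitsOfShape.condition (W := T) _ _ _ _
          (isColimitOfPreserves F h₁) (isColimitOfPreserves F h₂) (Functor.whiskerRight f F)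
          (fun j => hf j) (F.map φ) fun j => ?_
        exact (F.map_comp _ _).symm.trans ((congrArg F.map (hφ j)).trans (F.map_comp _ _)) }

instance (F : C ⥤ D) [PreservesColimitsOfSize.{v, v} F] (J : Type v) [LinearOrder J] :
    PreservesWellOrderContinuousOfShape J F where
  preservesColimitsOfShape _ _ := inferInstance

instance (T : MorphismProperty D) [MorphismProperty.IsStableUnderTransfiniteComposition.{v} T]
    (F : C ⥤ D) [PreservesColimitsOfSize.{v, v} F] :
    MorphismProperty.IsStableUnderTransfiniteComposition.{v} (T.inverseImage F) where
  isStableUnderTransfiniteCompositionOfShape J _ _ _ _ :=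
    { le := fun _ _ _ h => T.transfiniteCompositionsOfShape_le J _
        (MorphismProperty.transfiniteCompositionsOfShape_map_of_preserves J F _ h) }

theorem hasLiftingProperty_map_iff (F : C ⥤ D) [F.Full] [F.Faithful] {A B X Y : C} (i : A ⟶ B)
    (p : X ⟶ Y) : HasLiftingProperty (F.map i) (F.map p) ↔ HasLiftingProperty i p := by
  constructor
  · refine fun h => ⟨fun {u v} sq => ?_⟩
    have sq' := sq.map F
    exact ⟨⟨⟨F.preimage sq'.lift, F.map_injective (by simp), F.map_injective (by simp)⟩⟩⟩
  · refine fun h => ⟨fun {u v} sq => ?_⟩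
    have sq' : CommSq (F.preimage u) i p (F.preimage v) := ⟨F.map_injective (by simpa using sq.w)⟩
    exact ⟨⟨⟨F.map sq'.lift, by rw [← F.map_comp, sq'.fac_left, F.map_preimage],
      by rw [← F.map_comp, sq'.fac_right, F.map_preimage]⟩⟩⟩

variable {F : C ⥤ D} {G : D ⥤ C} (adj : F ⊣ G) {ι : Type*} {A B : ι → C} (i : ∀ n, A n ⟶ B n)

include adj

/-- If `p` lifts against every `F (i n)`, then `G p` lifts against every `i n`; transposing back, `F
f` lifts against `p`. -/
theorem rlp_llp_le_inverseImage :
    (MorphismProperty.ofHoms i).rlp.llp ≤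
      (MorphismProperty.ofHoms fun n => F.map (i n)).rlp.llp.inverseImage F := by
  intro X Y f hf Z W p hp
  rw [adj.hasLiftingProperty_iff]
  refine hf _ ((MorphismProperty.ofHoms_rlp_iff _ _).2 fun n => ?_)
  exact (adj.hasLiftingProperty_iff _ _).1 ((MorphismProperty.ofHoms_rlp_iff _ _).1 hp n)

/-- Maps from an object `F Z` to `Y` factor uniquely through the counit. The factorization of the
lower map is the lift, and uniqueness makes the upper triangle commute. -/
theorem hasLiftingProperty_counit [F.Full] [F.Faithful] {X X' : C} (f : X ⟶ X') (Y : D) :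
    HasLiftingProperty (F.map f) (adj.counit.app Y) := by
  have key {Z : C} {a b : F.obj Z ⟶ F.obj (G.obj Y)}
      (h : a ≫ adj.counit.app Y = b ≫ adj.counit.app Y) : a = b := by
    obtain ⟨a, rfl⟩ := F.map_surjective a
    obtain ⟨b, rfl⟩ := F.map_surjective b
    refine congrArg F.map ((adj.homEquiv _ _).symm.injective ?_)
    exact (adj.homEquiv_counit _ _ a).trans (h.trans (adj.homEquiv_counit _ _ b).symm)
  refine ⟨fun {u v} sq => ?_⟩
  have hv : F.map (adj.homEquiv X' Y v) ≫ adj.counit.app Y = v :=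
    (adj.homEquiv_counit _ _ _).symm.trans ((adj.homEquiv X' Y).symm_apply_apply v)
  refine ⟨⟨⟨F.map (adj.homEquiv X' Y v), key ?_, hv⟩⟩⟩
  exact (Category.assoc _ _ _).trans ((congrArg (F.map f ≫ ·) hv).trans sq.w.symm)

end Transport

theorem IsCardinalSmallRelativeTo.inverseImage {C : Type u} [Category.{v} C] [HasColimits C]
    {D : Type u'} [Category.{v} D] (F : C ⥤ D) [F.Full] [F.Faithful]
    [PreservesColimitsOfSize.{v, v} F] {κ : Cardinal.{v}} {T : MorphismProperty D} {A : C}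
    (h : IsCardinalSmallRelativeTo κ T (F.obj A)) :
    IsCardinalSmallRelativeTo κ (T.inverseImage F) A := by
  intro J _ _ _ _ _ hJ K _ hK
  have := h J hJ (K ⋙ F) hK
  let e : F ⋙ coyoneda.obj (Opposite.op (F.obj A)) ≅ coyoneda.obj (Opposite.op A) :=
    NatIso.ofComponents fun X => (Functor.FullyFaithful.ofFullyFaithful F).homEquiv.symm.toIso
  exact preservesColimit_of_natIso K e

/-! ### The model structures on spaces and on numerically generated spaces -/

section ModelStructuresOnSpaces

theorem closedT1Embeddings_of_compactSpace {A B : TopCat.{u}} [CompactSpace A] [T2Space B]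
    (f : A ⟶ B) (hf : Function.Injective f) : closedT1Embeddings f :=
  ⟨f.hom.continuous.isClosedEmbedding hf, fun _ _ => isClosed_singleton⟩

instance (n : ℕ) : T2Space (TopCat.disk.{u} n) :=
  inferInstanceAs (T2Space (ULift _))

instance (n : ℕ) : CompactSpace (diskProdInterval.{u} n) :=
  inferInstanceAs (CompactSpace (_ × _))

instance (n : ℕ) : T2Space (diskProdInterval.{u} n) :=
  inferInstanceAs (T2Space (_ × _))

instance (n : ℕ) : CompactSpace (diskProdZero.{u} n) :=
  inferInstanceAs (CompactSpace (_ × _))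

theorem boundaryInclusions_le : boundaryInclusions.{u} ≤ closedT1Embeddings := by
  rintro _ _ _ ⟨n⟩
  exact closedT1Embeddings_of_compactSpace _ ((TopCat.mono_iff_injective _).1 inferInstance)

theorem cylinderInclusions_le : cylinderInclusions.{u} ≤ closedT1Embeddings := by
  rintro _ _ _ ⟨n⟩
  exact closedT1Embeddings_of_compactSpace _ (Function.injective_id.prodMap Subtype.val_injective)

instance : MorphismProperty.IsSmall.{u} boundaryInclusions.{u} :=
  MorphismProperty.isSmall_ofHoms _

instance : MorphismProperty.IsSmall.{u} cylinderInclusions.{u} :=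
  MorphismProperty.isSmall_ofHoms _

theorem TopCat.exists_isFinitelyGeneratedBy :
    ∃ M : ModelCategory TopCat.{u}, IsFinitelyGeneratedBy M boundaryInclusions cylinderInclusions ∧
      HasWeakEquivalences M weakHomotopyEquivalences := by
  refine _root_.exists_isFinitelyGeneratedBy _ _ _ closedT1Embeddings boundaryInclusions_le
    cylinderInclusions_le ?_ ?_ boundaryInclusions_rlp_eq cylinderInclusions_rlp_llp_le
  · rintro _ _ _ ⟨n⟩
    exact ⟨isCardinalSmallRelativeTo_closedT1Embeddings 0 _,
      isCardinalSmallRelativeTo_closedT1Embeddings 0 _⟩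
  · rintro _ _ _ ⟨n⟩
    exact ⟨isCardinalSmallRelativeTo_closedT1Embeddings 0 _,
      isCardinalSmallRelativeTo_closedT1Embeddings 0 _⟩

namespace NG

instance : PreservesColimitsOfSize.{u, u} incl.{u} := adj.leftAdjoint_preservesColimits

instance : MorphismProperty.IsSmall.{u} boundaryInclusions.{u} :=
  MorphismProperty.isSmall_ofHoms _

instance : MorphismProperty.IsSmall.{u} cylinderInclusions.{u} :=
  MorphismProperty.isSmall_ofHoms _

theorem boundaryInclusions_rlp_eq :
    boundaryInclusions.rlp = _root_.boundaryInclusions.{u}.rlp.inverseImage incl := by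
  ext X Y f
  refine (MorphismProperty.ofHoms_rlp_iff _ f).trans
    (Iff.trans (forall_congr' fun n => ?_) (MorphismProperty.ofHoms_rlp_iff _ (incl.map f)).symm)
  exact (hasLiftingProperty_map_iff incl _ f).symm

theorem cylinderInclusions_rlp_eq :
    cylinderInclusions.rlp = _root_.cylinderInclusions.{u}.rlp.inverseImage incl := by
  ext X Y f
  refine (MorphismProperty.ofHoms_rlp_iff _ f).trans
    (Iff.trans (forall_congr' fun n => ?_) (MorphismProperty.ofHoms_rlp_iff _ (incl.map f)).symm)
  exact (hasLiftingProperty_map_iff incl _ f).symm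

theorem boundaryInclusions_rlp_llp_le :
    boundaryInclusions.rlp.llp ≤ _root_.boundaryInclusions.{u}.rlp.llp.inverseImage incl :=
  rlp_llp_le_inverseImage adj _

theorem cylinderInclusions_rlp_llp_le :
    cylinderInclusions.rlp.llp ≤ _root_.cylinderInclusions.{u}.rlp.llp.inverseImage incl :=
  rlp_llp_le_inverseImage adj _

instance : weakHomotopyEquivalences.{u}.HasTwoOutOfThreeProperty :=
  inferInstanceAs (MorphismProperty.HasTwoOutOfThreeProperty (MorphismProperty.inverseImage _ _))

theorem exists_isFinitelyGeneratedBy :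
    ∃ M : ModelCategory NG.{u}, IsFinitelyGeneratedBy M boundaryInclusions cylinderInclusions ∧
      HasWeakEquivalences M weakHomotopyEquivalences := by
  refine _root_.exists_isFinitelyGeneratedBy _ _ _ (closedT1Embeddings.inverseImage incl)
    ?_ ?_ ?_ ?_ ?_ ?_
  · rintro _ _ _ ⟨n⟩
    exact boundaryInclusions_le _ ⟨n⟩
  · rintro _ _ _ ⟨n⟩
    exact cylinderInclusions_le _ ⟨n⟩
  · rintro _ _ _ ⟨n⟩
    exact ⟨.inverseImage incl (isCardinalSmallRelativeTo_closedT1Embeddings 0 (.diskBoundary n)),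
      .inverseImage incl (isCardinalSmallRelativeTo_closedT1Embeddings 0 (.disk n))⟩
  · rintro _ _ _ ⟨n⟩
    exact ⟨.inverseImage incl
        (isCardinalSmallRelativeTo_closedT1Embeddings 0 (_root_.diskProdZero n)),
      .inverseImage incl
        (isCardinalSmallRelativeTo_closedT1Embeddings 0 (_root_.diskProdInterval n))⟩
  · rw [boundaryInclusions_rlp_eq, cylinderInclusions_rlp_eq, _root_.boundaryInclusions_rlp_eq]
    rfl
  · exact cylinderInclusions_rlp_llp_le.trans fun _ _ f hf =>
      _root_.cylinderInclusions_rlp_llp_le _ hf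

/-- Discs and spheres lie in `NG`, so the counit lifts against `I` and is a trivial fibration. -/
theorem weakHomotopyEquivalences_counit (Y : TopCat.{u}) :
    _root_.weakHomotopyEquivalences (adj.counit.app Y) := by
  have h : _root_.boundaryInclusions.rlp (adj.counit.app Y) :=
    (MorphismProperty.ofHoms_rlp_iff _ _).2 fun n => hasLiftingProperty_counit adj
      (ObjectProperty.homMk (TopCat.diskBoundaryInclusion.{u} n) : diskBoundary n ⟶ disk n) Y
  rw [_root_.boundaryInclusions_rlp_eq] at h
  exact h.2

/-- The map `f` is its adjoint followed by the counit, so two-out-of-three applies. -/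
theorem weakHomotopyEquivalences_homEquiv_iff {X : NG.{u}} {Y : TopCat.{u}} (f : incl.obj X ⟶ Y) :
    _root_.weakHomotopyEquivalences f ↔ weakHomotopyEquivalences (adj.homEquiv X Y f) := by
  have hf : incl.map (adj.homEquiv X Y f) ≫ adj.counit.app Y = f :=
    (adj.homEquiv_counit _ _ _).symm.trans ((adj.homEquiv X Y).symm_apply_apply f)
  conv_lhs => rw [← hf]
  exact MorphismProperty.postcomp_iff _ _ _ (weakHomotopyEquivalences_counit Y)

end NG

end ModelStructuresOnSpaces

theorem theorem3p3 :
    ∃ (MTop : ModelCategory TopCat.{u}) (MNG : ModelCategory NG.{u}),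
      (IsFinitelyGeneratedBy MTop boundaryInclusions cylinderInclusions ∧
        HasWeakEquivalences MTop weakHomotopyEquivalences) ∧
      (IsFinitelyGeneratedBy MNG NG.boundaryInclusions NG.cylinderInclusions ∧
        HasWeakEquivalences MNG NG.weakHomotopyEquivalences) ∧
      IsQuillenEquivalence MNG MTop NG.adj := by
  obtain ⟨MTop, hTop, hTop'⟩ := TopCat.exists_isFinitelyGeneratedBy.{u}
  obtain ⟨MNG, hNG, hNG'⟩ := NG.exists_isFinitelyGeneratedBy.{u}
  refine ⟨MTop, MNG, ⟨hTop, hTop'⟩, ⟨hNG, hNG'⟩, ⟨fun A B f hf => ?_, fun A B f hf => ?_⟩,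
    fun X Y _ _ f => ?_⟩
  · rw [hTop.cofibrations_eq]
    rw [hNG.cofibrations_eq] at hf
    exact NG.boundaryInclusions_rlp_llp_le f hf
  · rw [hTop.trivialCofibrations_eq]
    rw [hNG.trivialCofibrations_eq] at hf
    exact NG.cylinderInclusions_rlp_llp_le f hf
  · unfold HasWeakEquivalences at hTop' hNG'
    rw [hTop', hNG']
    exact NG.weakHomotopyEquivalences_homEquiv_iff f
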